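/- Let $n$ be an integer, $n\neq 0,1$. Consider the equations $$u_t+\alpha(t)u^nu_x+\beta(t)u_{xxx}+\sigma(t)u_{xxxxx}=0\qquad(\ast)$$ on regions $(t,x,u)\in I\times X\times U$, where $I,X,U\subseteq\mathbb R$ are nonempty open intervals ($0\notin U$ if $n<0$) and $\alpha,\beta,\sigma$ are smooth nonvanishing real functions on $I$. The gauged class is the subclass with $\alpha=1$. The maximal Lie invariance algebra $A^{\max}$ of an equation is the set of all smooth vector fields $Q=\tau\partial_t+\xi\partial_x+\eta\partial_u$ on $I\times X\times U$ (with $\tau,\xi,\eta$ functions of $(t,x,u)$) whose fifth prolongation $Q^{(5)}$, applied to the left-hand side of $(\ast)$, vanishes at every jet over the region that satisfies the equation. The kernel of a class on a given region is the intersection of the algebras $A^{\max}$ of all equations of the class on this region. Equivalence in the class $(\ast)$ is with respect to the transformations $\tilde t=T(t)$, $\tilde x=\delta_1x+\delta_2$, $\tilde u=\delta_3u$, $\tilde\alpha(\tilde t)=\frac{\delta_1}{\delta_3^nT_t}\alpha(t)$, $\tilde\beta(\tilde t)=\frac{\delta_1^3}{T_t}\beta(t)$, $\tilde\sigma(\tilde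 t)=\frac{\delta_1^5}{T_t}\sigma(t)$ with $T$ smooth on $I$, $T_t\ne0$, and constants $\delta_1\delta_3\neq0$, $\delta_2$. Equivalence in the gauged class is with respect to $\tilde t=\delta_1\delta_3^{-n}t+\delta_0$, $\tilde x=\delta_1x+\delta_2$, $\tilde u=\delta_3u$, $\tilde\beta(\tilde t)=\delta_1^2\delta_3^n\beta(t)$, $\tilde\sigma(\tilde t)=\delta_1^4\delta_3^n\sigma(t)$ with constants $\delta_1\delta_3\ne0$, $\delta_0,\delta_2$. The region is mapped to its image. **Theorem.** (i) On every region, the kernel of the gauged class and the kernel of the class $(\ast)$ both equal the one-dimensional algebra $\langle\partial_x\rangle$. (ii) Let $\alpha=1$ and let $\lambda,\delta$ be nonzero constants and $\rho$ a real constant. In each of the following cases $A^{\max}$ is two-dimensional, with the basis shown: 1. $\beta=\lambda t^{\rho}$, $\sigma=\delta t^{(5\rho+2)/3}$ with $I\subseteq(0,\infty)$: $\ \partial_x,\ 3nt\,\partial_t+(\rho+1)nx\,\partial_x+(\rho-2)u\,\partial_u$; 2. $\beta=\lambda e^{t}$, $\sigma=\delta e^{5t/3}$: $\ \partial_x,\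 3n\,\partial_t+nx\,\partial_x+u\,\partial_u$; 3. $\beta=\lambda$, $\sigma=\delta$: $\ \partial_x,\ \partial_t$. (iii) Every equation of the gauged class, and every equation of the class $(\ast)$, whose algebra $A^{\max}$ differs from $\langle\partial_x\rangle$ is equivalent, in the respective class, to an equation with $\alpha=1$ of one of the cases 1–3 with $\delta=\pm1$. (iv) In either class, an equation of one of the cases 1 (with given $\rho$), 2, 3 is never equivalent to an equation of another one of these cases, nor to one of case 1 with a different $\rho$. -/

import Mathlib

open Set
open scoped ContDiff

noncomputable section

namespace Kawahara

/-! ### Jets, total derivatives, prolongation -/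

/-- A point of the (infinite) jet space over the `(t, x)`-plane with one dependent variable `u`;
`u i k` is the coordinate of `∂_t^i ∂_x^k u`, so `u 0 0` is the coordinate of `u` itself. -/
structure Jet where
  t : ℝ
  x : ℝ
  u : ℕ → ℕ → ℝ

/-- The projection of a jet to the space of the variables `(t, x, u)`. -/
def Jet.point (j : Jet) : ℝ × ℝ × ℝ := (j.t, j.x, j.u 0 0)

/-- Total derivative `D_x = ∂_x + u_x ∂_u + u_{tx} ∂_{u_t} + u_{xx} ∂_{u_x} + ⋯`, written as the
derivative in the direction `(0, 1, (u_{i,k+1}))`. -/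
def Dx (F : Jet → ℝ) (j : Jet) : ℝ :=
  deriv (fun s : ℝ => F ⟨j.t, j.x + s, fun i k => j.u i k + s * j.u i (k + 1)⟩) 0

/-- Total derivative `D_t = ∂_t + u_t ∂_u + u_{tt} ∂_{u_t} + u_{tx} ∂_{u_x} + ⋯`, written as the
derivative in the direction `(1, 0, (u_{i+1,k}))`. -/
def Dt (F : Jet → ℝ) (j : Jet) : ℝ :=
  deriv (fun s : ℝ => F ⟨j.t + s, j.x, fun i k => j.u i k + s * j.u (i + 1) k⟩) 0

/-- A vector field `τ ∂_t + ξ ∂_x + η ∂_u` on the space of the variables `(t, x, u)`, as the map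
`(t, x, u) ↦ (τ, ξ, η)`. -/
abbrev VField : Type := ℝ × ℝ × ℝ → ℝ × ℝ × ℝ

def VField.τ (Q : VField) (j : Jet) : ℝ := (Q j.point).1
def VField.ξ (Q : VField) (j : Jet) : ℝ := (Q j.point).2.1
def VField.η (Q : VField) (j : Jet) : ℝ := (Q j.point).2.2

/-- The coefficient of `∂/∂(∂_t^i u)` in the prolongation of `Q`. -/
def prolongT (Q : VField) : ℕ → Jet → ℝ
  | 0 => Q.η
  | i + 1 => fun j =>
      Dt (prolongT Q i) j - j.u (i + 1) 0 * Dt Q.τ j - j.u i 1 * Dt Q.ξ j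

/-- The coefficient of `∂/∂(∂_t^i ∂_x^k u)` in the prolongation of `Q`. -/
def prolong (Q : VField) (i : ℕ) : ℕ → Jet → ℝ
  | 0 => prolongT Q i
  | k + 1 => fun j =>
      Dx (prolong Q i k) j - j.u (i + 1) k * Dx Q.τ j - j.u i (k + 1) * Dx Q.ξ j

/-- The prolonged vector field applied to a function `E` on the jet space (a directional
derivative). For `E` depending on derivatives of order at most five this is `Q^{(5)} E`. -/
def prolongApply (Q : VField) (E : Jet → ℝ) (j : Jet) : ℝ :=
  deriv (fun s : ℝ =>
    E ⟨j.t + s * Q.τ j, j.x + s * Q.ξ j, fun i k => j.u i k + s * prolong Q i k j⟩) 0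

/-! ### The equations and their maximal Lie invariance algebras -/

/-- Left-hand side of `u_t + α(t) u^n u_x + β(t) u_xxx + σ(t) u_xxxxx = 0`. -/
def lhs (n : ℤ) (α β σ : ℝ → ℝ) (j : Jet) : ℝ :=
  j.u 1 0 + α j.t * j.u 0 0 ^ n * j.u 0 1 + β j.t * j.u 0 3 + σ j.t * j.u 0 5

/-- The ranges of the variables `t`, `x` and `u`. -/
structure Box where
  I : Set ℝ
  X : Set ℝ
  U : Set ℝ

/-- The region `I × X × U` of the space of the variables `(t, x, u)`. -/
def Box.toSet (D : Box) : Set (ℝ × ℝ × ℝ) := D.I ×ˢ D.X ×ˢ D.U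

/-- `I`, `X`, `U` are nonempty open intervals, and `u ≠ 0` on the region if `n < 0`. -/
structure Box.Admissible (D : Box) (n : ℤ) : Prop where
  isOpen_I : IsOpen D.I
  conn_I : IsConnected D.I
  isOpen_X : IsOpen D.X
  conn_X : IsConnected D.X
  isOpen_U : IsOpen D.U
  conn_U : IsConnected D.U
  zero_notMem : n < 0 → (0 : ℝ) ∉ D.U

/-- Smooth nonvanishing functions on `I`: the admissible values of the coefficients. -/
def IsCoeff (I : Set ℝ) (f : ℝ → ℝ) : Prop := ContDiffOn ℝ ∞ f I ∧ ∀ t ∈ I, f t ≠ 0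

/-- The gauge `α = 1`. -/
def one : ℝ → ℝ := fun _ => 1

/-- The maximal Lie invariance algebra of
`u_t + α(t) u^n u_x + β(t) u_xxx + σ(t) u_xxxxx = 0` on the region `I × X × U`: all smooth vector
fields `Q` on the region such that `Q^{(5)}` applied to the left-hand side vanishes at all jets
over the region that satisfy the equation. -/
def maxAlg (n : ℤ) (D : Box) (α β σ : ℝ → ℝ) : Set (D.toSet → ℝ × ℝ × ℝ) :=
  {v | ∃ Q : VField, ContDiffOn ℝ ∞ Q D.toSet ∧
      (∀ j : Jet, j.point ∈ D.toSet → lhs n α β σ j = 0 → prolongApply Q (lhs n α β σ) j = 0) ∧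
      D.toSet.domRestrict Q = v}

/-- The kernel of the maximal Lie invariance algebras of the class with `α = 1`. -/
def kernelGauged (n : ℤ) (D : Box) : Set (D.toSet → ℝ × ℝ × ℝ) :=
  {v | ∀ β σ : ℝ → ℝ, IsCoeff D.I β → IsCoeff D.I σ → v ∈ maxAlg n D one β σ}

/-- The kernel of the maximal Lie invariance algebras of the class with general `α`. -/
def kernelGeneral (n : ℤ) (D : Box) : Set (D.toSet → ℝ × ℝ × ℝ) :=
  {v | ∀ α β σ : ℝ → ℝ, IsCoeff D.I α → IsCoeff D.I β → IsCoeff D.I σ → v ∈ maxAlg n D α β σ}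

/-- The vector field `∂_x`. -/
def partialX : VField := fun _ => (0, 1, 0)

/-- The one-dimensional algebra `⟨∂_x⟩` of vector fields on the region. -/
def spanX (D : Box) : Set (D.toSet → ℝ × ℝ × ℝ) :=
  (Submodule.span ℝ {D.toSet.domRestrict partialX} : Submodule ℝ (D.toSet → ℝ × ℝ × ℝ))

/-- `A` is a vector space of vector fields on the region, and the restrictions of `b 0, b 1, …`
form a basis of it. -/
def IsBasisOf {k : ℕ} (D : Box) (b : Fin k → VField) (A : Set (D.toSet → ℝ × ℝ × ℝ)) : Prop :=
  LinearIndependent ℝ (fun i => D.toSet.domRestrict (b i)) ∧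
    A = (Submodule.span ℝ (range fun i => D.toSet.domRestrict (b i)) :
      Submodule ℝ (D.toSet → ℝ × ℝ × ℝ))

/-! ### Equivalence transformations -/

/-- An element of the equivalence group of the class with `α = 1`:
`t' = δ₁ δ₃⁻ⁿ t + δ₀`, `x' = δ₁ x + δ₂`, `u' = δ₃ u`, `δ₁ δ₃ ≠ 0`. -/
structure GaugedTransf where
  δ₀ : ℝ
  δ₁ : ℝ
  δ₂ : ℝ
  δ₃ : ℝ
  δ₁_ne : δ₁ ≠ 0
  δ₃_ne : δ₃ ≠ 0

def GaugedTransf.time (g : GaugedTransf) (n : ℤ) (t : ℝ) : ℝ := g.δ₁ * g.δ₃ ^ (-n) * t + g.δ₀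

/-- The image of a region. -/
def GaugedTransf.box (g : GaugedTransf) (n : ℤ) (D : Box) : Box :=
  ⟨g.time n '' D.I, (fun x => g.δ₁ * x + g.δ₂) '' D.X, (fun u => g.δ₃ * u) '' D.U⟩

/-- `g` maps the equation with `α = 1` and coefficients `β, σ` on `D` to the one with `α = 1` and
coefficients `β', σ'` on `D'`. -/
def GaugedTransf.Maps (g : GaugedTransf) (n : ℤ) (D : Box) (β σ : ℝ → ℝ)
    (D' : Box) (β' σ' : ℝ → ℝ) : Prop :=
  D' = g.box n D ∧ ∀ t ∈ D.I,
    β' (g.time n t) = g.δ₁ ^ 2 * g.δ₃ ^ n * β t ∧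
    σ' (g.time n t) = g.δ₁ ^ 4 * g.δ₃ ^ n * σ t

/-- Equivalence within the class with `α = 1`. -/
def GaugedEquiv (n : ℤ) (D : Box) (β σ : ℝ → ℝ) (D' : Box) (β' σ' : ℝ → ℝ) : Prop :=
  ∃ g : GaugedTransf, g.Maps n D β σ D' β' σ'

/-- An element of the equivalence group of the class with general `α`, considered over the
interval `I`: `t' = T(t)`, `x' = δ₁ x + δ₂`, `u' = δ₃ u`, with `T` smooth, `T_t ≠ 0`,
`δ₁ δ₃ ≠ 0`. -/
structure GeneralTransf (I : Set ℝ) where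
  T : ℝ → ℝ
  δ₁ : ℝ
  δ₂ : ℝ
  δ₃ : ℝ
  smooth_T : ContDiffOn ℝ ∞ T I
  deriv_T_ne : ∀ t ∈ I, deriv T t ≠ 0
  δ₁_ne : δ₁ ≠ 0
  δ₃_ne : δ₃ ≠ 0

/-- The image of a region. -/
def GeneralTransf.box {D : Box} (g : GeneralTransf D.I) : Box :=
  ⟨g.T '' D.I, (fun x => g.δ₁ * x + g.δ₂) '' D.X, (fun u => g.δ₃ * u) '' D.U⟩

/-- `g` maps the equation with coefficients `α, β, σ` on `D` to the one with coefficients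
`α', β', σ'` on `D'`. -/
def GeneralTransf.Maps {D : Box} (g : GeneralTransf D.I) (n : ℤ) (α β σ : ℝ → ℝ)
    (D' : Box) (α' β' σ' : ℝ → ℝ) : Prop :=
  D' = g.box ∧ ∀ t ∈ D.I,
    α' (g.T t) = g.δ₁ / (g.δ₃ ^ n * deriv g.T t) * α t ∧
    β' (g.T t) = g.δ₁ ^ 3 / deriv g.T t * β t ∧
    σ' (g.T t) = g.δ₁ ^ 5 / deriv g.T t * σ t

/-- Equivalence within the class with general `α`. -/
def GeneralEquiv (n : ℤ) (D : Box) (α β σ : ℝ → ℝ) (D' : Box) (α' β' σ' : ℝ → ℝ) : Prop :=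
  ∃ g : GeneralTransf D.I, g.Maps n α β σ D' α' β' σ'

/-! ### The list of extensions -/

/-- The cases of the classification: power coefficients with exponent `ρ`, exponential
coefficients, constant coefficients. -/
inductive ExtCase where
  | power (ρ : ℝ)
  | exponential
  | constant

namespace ExtCase

/-- The values of `t` at which the coefficients of the case are considered. -/
def times : ExtCase → Set ℝ
  | power _ => Ioi 0
  | exponential => univ
  | constant => univ

/-- The coefficient `β` of the case with factor `l`. -/
def β (c : ExtCase) (l : ℝ) (t : ℝ) : ℝ :=
  match c with
  | power ρ => l * t ^ ρ
  | exponential => l * Real.exp t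
  | constant => l

/-- The coefficient `σ` of the case with factor `d`. -/
def σ (c : ExtCase) (d : ℝ) (t : ℝ) : ℝ :=
  match c with
  | power ρ => d * t ^ ((5 * ρ + 2) / 3)
  | exponential => d * Real.exp (5 / 3 * t)
  | constant => d

/-- The second basis vector field of the case:
`3nt ∂_t + (ρ + 1)nx ∂_x + (ρ - 2)u ∂_u`, `3n ∂_t + nx ∂_x + u ∂_u`, `∂_t`. -/
def generator (c : ExtCase) (n : ℤ) : VField := fun p =>
  match c with
  | power ρ => (3 * n * p.1, (ρ + 1) * n * p.2.1, (ρ - 2) * p.2.2)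
  | exponential => (3 * n, n * p.2.1, p.2.2)
  | constant => (1, 0, 0)

end ExtCase

end Kawahara

end

open Set
open scoped ContDiff

noncomputable section

namespace Kawahara


/-! ### Partial derivatives on the space of the variables -/

/-! The proof is Lie's infinitesimal method. On the solution set of the equation the coordinate
`u_t` is a function of the `x`-derivatives of `u`, while the `u_{x…x}` and the `u_{tx…x}` with at
least one `x` stay free, so the invariance condition can be split with respect to these free
coordinates. The coefficient of `u_{txxxx}` is `-5σ D_x τ`, so `τ = τ(t)`. The coefficient of
`u_{xxxxx}` then gives `ξ_u = 0` and `σ'τ + σ(τ_t - 5ξ_x) = 0`, so `ξ_x` depends only on `t`. After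
that the coefficient of `u_{xxxx}` is `5σ D_x(η_u)`, so `η_u` depends only on `t`. What remains are
the coefficients of `1`, `u_x` and `u_{xxx}` (`IsSymmetry.reduced`). For `n ≠ 0, 1` the functions
`u^n, u^(n-1), 1` are independent, which removes the `u`-free part of `η` and makes `ξ` independent
of `t`.

Hence every symmetry is `τ(t)∂_t + (c₁x + c₀)∂_x + c₂u∂_u` with `(ατ)' = (c₁ - nc₂)α`, `(βτ)' =
3c₁β`, `(στ)' = 5c₁σ`, and conversely (`mem_maxAlg_iff`). Bases and kernels follow by solving these
equations for the listed coefficients.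

For the classification let `A' = α` and `a = c₁ - nc₂`. Then `ατ = aA + y₀`, which vanishes nowhere
unless the field is a multiple of `∂_x`. As functions of `A`, the ratios `β/α` and `σ/α` satisfy
linear equations with powers (`a ≠ 0`), exponentials (`a = 0 ≠ c₁`) or constants (`a = c₁ = 0`) as
solutions (`exists_extCase_of_maxAlg_ne`). An affine function of `A` serves as the new time, and a
scaling turns the factor of `σ` into `±1`. Inequivalence is read off from logarithmic derivatives:
between equations with `α = 1` the change of time is affine, and `5β'/β - 3σ'/σ` equals `-2/t` for
powers and `0` otherwise.

To split rigorously, `IsDiffPoly` records which jet coordinates an expression may involve; the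
determining equation is then evaluated at two jets differing in the chosen coordinate and
subtracted. -/

/-- The partial derivative `∂f/∂t`. -/
def dT (f : ℝ × ℝ × ℝ → ℝ) (p : ℝ × ℝ × ℝ) : ℝ := fderiv ℝ f p (1, 0, 0)

/-- The partial derivative `∂f/∂x`. -/
def dX (f : ℝ × ℝ × ℝ → ℝ) (p : ℝ × ℝ × ℝ) : ℝ := fderiv ℝ f p (0, 1, 0)

/-- The partial derivative `∂f/∂u`. -/
def dU (f : ℝ × ℝ × ℝ → ℝ) (p : ℝ × ℝ × ℝ) : ℝ := fderiv ℝ f p (0, 0, 1)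

lemma fderiv_eq_partials (f : ℝ × ℝ × ℝ → ℝ) (p : ℝ × ℝ × ℝ) (a b c : ℝ) :
    fderiv ℝ f p (a, b, c) = a * dT f p + b * dX f p + c * dU f p := by
  have : ((a, b, c) : ℝ × ℝ × ℝ)
      = a • ((1, 0, 0) : ℝ × ℝ × ℝ) + b • ((0, 1, 0) : ℝ × ℝ × ℝ) + c • ((0, 0, 1) : ℝ × ℝ × ℝ) := by
    simp
  rw [this, map_add, map_add, map_smul, map_smul, map_smul]
  simp [dT, dX, dU]

section Smooth

variable {Ω : Set (ℝ × ℝ × ℝ)} {f : ℝ × ℝ × ℝ → ℝ}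

lemma contDiffOn_fderiv_apply (hΩ : IsOpen Ω) (hf : ContDiffOn ℝ ∞ f Ω) (v : ℝ × ℝ × ℝ) :
    ContDiffOn ℝ ∞ (fun p => fderiv ℝ f p v) Ω :=
  (hf.fderiv_of_isOpen hΩ (m := ∞) (by simp)).clm_apply contDiffOn_const

lemma contDiffOn_dX (hΩ : IsOpen Ω) (hf : ContDiffOn ℝ ∞ f Ω) : ContDiffOn ℝ ∞ (dX f) Ω :=
  contDiffOn_fderiv_apply hΩ hf _

lemma contDiffOn_dU (hΩ : IsOpen Ω) (hf : ContDiffOn ℝ ∞ f Ω) : ContDiffOn ℝ ∞ (dU f) Ω :=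
  contDiffOn_fderiv_apply hΩ hf _

lemma differentiableAt_of_smooth (hΩ : IsOpen Ω) (hf : ContDiffOn ℝ ∞ f Ω) {p : ℝ × ℝ × ℝ}
    (hp : p ∈ Ω) : DifferentiableAt ℝ f p :=
  (hf.differentiableOn (by simp)).differentiableAt (hΩ.mem_nhds hp)

end Smooth

lemma dX_congr {Ω : Set (ℝ × ℝ × ℝ)} (hΩ : IsOpen Ω) {f g : ℝ × ℝ × ℝ → ℝ} (h : EqOn f g Ω)
    {p : ℝ × ℝ × ℝ} (hp : p ∈ Ω) : dX f p = dX g p := by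
  rw [dX, dX, (h.eventuallyEq_of_mem (hΩ.mem_nhds hp)).fderiv_eq]

/-! ### Differential polynomials -/

/-- The line through a jet whose velocity is the total derivative `D_x`. -/
def Jet.lineX (j : Jet) (s : ℝ) : Jet := ⟨j.t, j.x + s, fun i k => j.u i k + s * j.u i (k + 1)⟩

/-- The line through a jet whose velocity is the total derivative `D_t`. -/
def Jet.lineT (j : Jet) (s : ℝ) : Jet := ⟨j.t + s, j.x, fun i k => j.u i k + s * j.u (i + 1) k⟩

lemma Jet.lineX_zero (j : Jet) : j.lineX 0 = j := by simp [Jet.lineX]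

lemma Dx_def (F : Jet → ℝ) (j : Jet) : Dx F j = deriv (fun s => F (j.lineX s)) 0 := rfl

lemma hasDerivAt_add_mul_const (a b : ℝ) : HasDerivAt (fun s : ℝ => a + s * b) b 0 := by
  have h := ((hasDerivAt_id (0 : ℝ)).mul_const b).const_add a
  rwa [one_mul] at h

lemma Jet.hasDerivAt_lineX_point (j : Jet) :
    HasDerivAt (fun s => (j.lineX s).point) ((0, 1, j.u 0 1) : ℝ × ℝ × ℝ) 0 := by
  refine (hasDerivAt_const _ _).prodMk (HasDerivAt.prodMk ?_ ?_)
  · exact (hasDerivAt_id (0 : ℝ)).const_add j.x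
  · exact hasDerivAt_add_mul_const _ _

lemma Jet.hasDerivAt_lineT_point (j : Jet) :
    HasDerivAt (fun s => (j.lineT s).point) ((1, 0, j.u 1 0) : ℝ × ℝ × ℝ) 0 := by
  refine HasDerivAt.prodMk ?_ ((hasDerivAt_const _ _).prodMk ?_)
  · exact (hasDerivAt_id (0 : ℝ)).const_add j.t
  · exact hasDerivAt_add_mul_const _ _

lemma hasDerivAt_comp_lineX {f : ℝ × ℝ × ℝ → ℝ} {j : Jet} (hf : DifferentiableAt ℝ f j.point) :
    HasDerivAt (fun s => f (j.lineX s).point) (dX f j.point + j.u 0 1 * dU f j.point) 0 := by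
  have h := HasFDerivAt.comp_hasDerivAt_of_eq (0 : ℝ) hf.hasFDerivAt j.hasDerivAt_lineX_point
    (by rw [Jet.lineX_zero])
  rw [fderiv_eq_partials, zero_mul, one_mul, zero_add] at h
  exact h

lemma Dx_comp_point {f : ℝ × ℝ × ℝ → ℝ} {j : Jet} (hf : DifferentiableAt ℝ f j.point) :
    Dx (fun j => f j.point) j = dX f j.point + j.u 0 1 * dU f j.point :=
  (hasDerivAt_comp_lineX hf).deriv

lemma Dt_comp_point {f : ℝ × ℝ × ℝ → ℝ} {j : Jet} (hf : DifferentiableAt ℝ f j.point) :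
    Dt (fun j => f j.point) j = dT f j.point + j.u 1 0 * dU f j.point := by
  have h := HasFDerivAt.comp_hasDerivAt_of_eq (0 : ℝ) hf.hasFDerivAt j.hasDerivAt_lineT_point
    (by simp [Jet.lineT])
  rw [fderiv_eq_partials] at h
  have h2 := h.deriv
  simp only [one_mul, zero_mul, add_zero] at h2
  exact h2

lemma hasDerivAt_coord_lineX (i k : ℕ) (j : Jet) :
    HasDerivAt (fun s => (j.lineX s).u i k) (j.u i (k + 1)) 0 :=
  hasDerivAt_add_mul_const _ _

lemma Dx_coord (i k : ℕ) (j : Jet) : Dx (fun j => j.u i k) j = j.u i (k + 1) :=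
  (hasDerivAt_coord_lineX i k j).deriv

lemma Jet.eventually_lineX_mem {Ω : Set (ℝ × ℝ × ℝ)} (hΩ : IsOpen Ω) {j : Jet}
    (hj : j.point ∈ Ω) : ∀ᶠ s in nhds (0 : ℝ), (j.lineX s).point ∈ Ω :=
  j.hasDerivAt_lineX_point.continuousAt.eventually_mem
    (hΩ.mem_nhds (by rwa [Jet.lineX_zero]))

/-- Since `Ω` is open, the line defining `D_x` stays over `Ω` for small parameters. This lets
formulas known only over the region be differentiated again. -/
lemma Dx_congr {Ω : Set (ℝ × ℝ × ℝ)} (hΩ : IsOpen Ω) {F G : Jet → ℝ}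
    (h : ∀ j : Jet, j.point ∈ Ω → F j = G j) {j : Jet} (hj : j.point ∈ Ω) : Dx F j = Dx G j := by
  rw [Dx_def, Dx_def]
  exact Filter.EventuallyEq.deriv_eq ((j.eventually_lineX_mem hΩ hj).mono fun s hs => h _ hs)

/-- The functions on the jets over `Ω` that are polynomials in the jet coordinates from `S` with
coefficients depending smoothly on the point of `Ω`. -/
inductive IsDiffPoly (Ω : Set (ℝ × ℝ × ℝ)) (S : Set (ℕ × ℕ)) : (Jet → ℝ) → Prop
  | base (f : ℝ × ℝ × ℝ → ℝ) (hf : ContDiffOn ℝ ∞ f Ω) : IsDiffPoly Ω S (fun j => f j.point)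
  | coord (i k : ℕ) (h : (i, k) ∈ S) : IsDiffPoly Ω S (fun j => j.u i k)
  | add (F G : Jet → ℝ) (hF : IsDiffPoly Ω S F) (hG : IsDiffPoly Ω S G) :
      IsDiffPoly Ω S (fun j => F j + G j)
  | mul (F G : Jet → ℝ) (hF : IsDiffPoly Ω S F) (hG : IsDiffPoly Ω S G) :
      IsDiffPoly Ω S (fun j => F j * G j)
  | congr (F G : Jet → ℝ) (hF : IsDiffPoly Ω S F)
      (h : ∀ j : Jet, j.point ∈ Ω → F j = G j) : IsDiffPoly Ω S G

namespace IsDiffPoly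

variable {Ω : Set (ℝ × ℝ × ℝ)} {S S' : Set (ℕ × ℕ)} {F G : Jet → ℝ}

lemma const (c : ℝ) : IsDiffPoly Ω S (fun _ => c) := base (fun _ => c) contDiffOn_const

lemma mono (hF : IsDiffPoly Ω S F) (h : S ⊆ S') : IsDiffPoly Ω S' F := by
  induction hF with
  | base f hf => exact base f hf
  | coord i k hik => exact coord i k (h hik)
  | add F G _ _ ihF ihG => exact add F G ihF ihG
  | mul F G _ _ ihF ihG => exact mul F G ihF ihG
  | congr F G _ hFG ihF => exact congr F G ihF hFG

lemma sub (hF : IsDiffPoly Ω S F) (hG : IsDiffPoly Ω S G) :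
    IsDiffPoly Ω S (fun j => F j - G j) :=
  congr _ _ (add _ _ hF (mul _ _ (const (-1)) hG)) fun j _ => by ring

/-- The reason for tracking `S`: a remainder term is unaffected by changing coordinates outside `S`,
so it cancels when two determining equations are subtracted. -/
lemma eq_of_agree (hF : IsDiffPoly Ω S F) {j j' : Jet} (hj : j.point ∈ Ω)
    (hp : j'.point = j.point) (hu : ∀ i k, (i, k) ∈ S → j'.u i k = j.u i k) : F j' = F j := by
  induction hF with
  | base f hf => exact congrArg f hp
  | coord i k hik => exact hu i k hik
  | add F G _ _ ihF ihG => simp only [ihF, ihG]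
  | mul F G _ _ ihF ihG => simp only [ihF, ihG]
  | congr F G _ hFG ihF => rw [← hFG j hj, ← hFG j' (hp ▸ hj), ihF]

/-- `Dx` is a `deriv`, with junk value `0` where differentiability fails, so the sum and product
rules below depend on this. -/
lemma differentiableAt (hΩ : IsOpen Ω) (hF : IsDiffPoly Ω S F) {j : Jet} (hj : j.point ∈ Ω) :
    DifferentiableAt ℝ (fun s => F (j.lineX s)) 0 := by
  induction hF with
  | base f hf => exact (hasDerivAt_comp_lineX (differentiableAt_of_smooth hΩ hf hj)).differentiableAt
  | coord i k hik => exact (hasDerivAt_coord_lineX i k j).differentiableAt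
  | add F G _ _ ihF ihG => exact ihF.add ihG
  | mul F G _ _ ihF ihG => exact ihF.mul ihG
  | congr F G _ hFG ihF =>
    exact ihF.congr_of_eventuallyEq
      ((j.eventually_lineX_mem hΩ hj).mono fun s hs => (hFG _ hs).symm)

lemma Dx_add (hΩ : IsOpen Ω) (hF : IsDiffPoly Ω S F) (hG : IsDiffPoly Ω S' G) {j : Jet}
    (hj : j.point ∈ Ω) : Dx (fun j => F j + G j) j = Dx F j + Dx G j :=
  deriv_fun_add (hF.differentiableAt hΩ hj) (hG.differentiableAt hΩ hj)

lemma Dx_mul (hΩ : IsOpen Ω) (hF : IsDiffPoly Ω S F) (hG : IsDiffPoly Ω S' G) {j : Jet}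
    (hj : j.point ∈ Ω) : Dx (fun j => F j * G j) j = Dx F j * G j + F j * Dx G j := by
  have h := deriv_fun_mul (hF.differentiableAt hΩ hj) (hG.differentiableAt hΩ hj)
  rw [Jet.lineX_zero] at h
  exact h

lemma Dx_const_mul (hΩ : IsOpen Ω) (hF : IsDiffPoly Ω S F) (c : ℝ) {j : Jet}
    (hj : j.point ∈ Ω) : Dx (fun j => c * F j) j = c * Dx F j :=
  deriv_const_mul c (hF.differentiableAt hΩ hj)

/-- The coordinate `u_x` enters through the chain rule for coefficients depending on `u`, and each
coordinate of `S` contributes its `x`-shift; the product rule keeps the old ones as well. -/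
protected lemma Dx (hΩ : IsOpen Ω) (hF : IsDiffPoly Ω S F) (hS : S ⊆ S') (h01 : (0, 1) ∈ S')
    (hS' : ∀ i k, (i, k) ∈ S → (i, k + 1) ∈ S') : IsDiffPoly Ω S' (Dx F) := by
  induction hF with
  | base f hf =>
    refine congr _ _ (add _ _ (base _ (contDiffOn_dX hΩ hf))
      (mul _ _ (coord 0 1 h01) (base _ (contDiffOn_dU hΩ hf)))) fun j hj => ?_
    exact (Dx_comp_point (differentiableAt_of_smooth hΩ hf hj)).symm
  | coord i k hik =>
    exact congr _ _ (coord i (k + 1) (hS' i k hik)) fun j _ => (Dx_coord i k j).symm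
  | add F G hF hG ihF ihG =>
    exact congr _ _ (add _ _ ihF ihG) fun j hj => (Dx_add hΩ hF hG hj).symm
  | mul F G hF hG ihF ihG =>
    exact congr _ _ (add _ _ (mul _ _ ihF (hG.mono hS)) (mul _ _ (hF.mono hS) ihG))
      fun j hj => (Dx_mul hΩ hF hG hj).symm
  | congr F G hF hFG ihF =>
    exact congr _ _ ihF fun j hj => Dx_congr hΩ hFG hj

end IsDiffPoly


/-! ### The structure of the prolongation coefficients -/

lemma dU_dX_comm {Ω : Set (ℝ × ℝ × ℝ)} (hΩ : IsOpen Ω) {f : ℝ × ℝ × ℝ → ℝ}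
    (hf : ContDiffOn ℝ ∞ f Ω) {p : ℝ × ℝ × ℝ} (hp : p ∈ Ω) : dU (dX f) p = dX (dU f) p := by
  have hc : ContDiffAt ℝ ∞ f p := hf.contDiffAt (hΩ.mem_nhds hp)
  have hd : DifferentiableAt ℝ (fderiv ℝ f) p :=
    (hc.fderiv_right (m := ∞) (by simp)).differentiableAt (by simp)
  have hs := (hc.isSymmSndFDerivAt (by
    rw [minSmoothness_of_isRCLikeNormedField]; exact WithTop.coe_le_coe.2 le_top)).eq
    (0, 0, 1) (0, 1, 0)
  have key : ∀ v w : ℝ × ℝ × ℝ,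
      fderiv ℝ (fun q => fderiv ℝ f q v) p w = fderiv ℝ (fderiv ℝ f) p w v := fun v w => by
    rw [fderiv_clm_apply hd (differentiableAt_const v)]
    simp
  exact (key _ _).trans (hs.trans (key _ _).symm)

lemma prolong_succ (Q : VField) (k : ℕ) (j : Jet) : prolong Q 0 (k + 1) j =
    Dx (prolong Q 0 k) j - j.u 1 k * Dx Q.τ j - j.u 0 (k + 1) * Dx Q.ξ j := rfl

lemma prolong_time (Q : VField) (j : Jet) : prolong Q 1 0 j =
    Dt Q.η j - j.u 1 0 * Dt Q.τ j - j.u 0 1 * Dt Q.ξ j := rfl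

variable {Ω : Set (ℝ × ℝ × ℝ)} {Q : VField}

lemma contDiffOn_fst (hQ : ContDiffOn ℝ ∞ Q Ω) : ContDiffOn ℝ ∞ (fun p => (Q p).1) Ω :=
  contDiff_fst.comp_contDiffOn hQ

lemma contDiffOn_snd_fst (hQ : ContDiffOn ℝ ∞ Q Ω) : ContDiffOn ℝ ∞ (fun p => (Q p).2.1) Ω :=
  (contDiff_fst.comp contDiff_snd).comp_contDiffOn hQ

lemma contDiffOn_snd_snd (hQ : ContDiffOn ℝ ∞ Q Ω) : ContDiffOn ℝ ∞ (fun p => (Q p).2.2) Ω :=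
  (contDiff_snd.comp contDiff_snd).comp_contDiffOn hQ

lemma isDiffPoly_τ (hQ : ContDiffOn ℝ ∞ Q Ω) (S : Set (ℕ × ℕ)) : IsDiffPoly Ω S Q.τ :=
  .base _ (contDiffOn_fst hQ)

lemma isDiffPoly_ξ (hQ : ContDiffOn ℝ ∞ Q Ω) (S : Set (ℕ × ℕ)) : IsDiffPoly Ω S Q.ξ :=
  .base _ (contDiffOn_snd_fst hQ)

lemma isDiffPoly_η (hQ : ContDiffOn ℝ ∞ Q Ω) (S : Set (ℕ × ℕ)) : IsDiffPoly Ω S Q.η :=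
  .base _ (contDiffOn_snd_snd hQ)

/-- The coefficient of `u_{t x…x}` of the highest order in the prolongation coefficients. -/
lemma exists_prolong_eq_mixed (hΩ : IsOpen Ω) (hQ : ContDiffOn ℝ ∞ Q Ω) (k : ℕ) :
    ∃ G, IsDiffPoly Ω {p | p.1 = 0 ∨ p.2 < k} G ∧ ∀ j : Jet, j.point ∈ Ω →
      prolong Q 0 (k + 1) j = -(k + 1) * (Dx Q.τ j * j.u 1 k) + G j := by
  have hDx : ∀ {S : Set (ℕ × ℕ)} {F : Jet → ℝ}, IsDiffPoly Ω ∅ F → (0, 1) ∈ S →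
      IsDiffPoly Ω S (Dx F) := fun h h01 => h.Dx hΩ (empty_subset _) h01 (by simp)
  induction k with
  | zero =>
    refine ⟨fun j => Dx Q.η j - j.u 0 1 * Dx Q.ξ j,
      (hDx (isDiffPoly_η hQ _) (by simp)).sub
        (.mul _ _ (.coord 0 1 (by simp)) (hDx (isDiffPoly_ξ hQ _) (by simp))), fun j _ => ?_⟩
    rw [prolong_succ]
    simp only [Nat.cast_zero, zero_add]
    rw [show prolong Q 0 0 = Q.η from rfl]
    ring
  | succ k ih =>
    obtain ⟨G, hG, h⟩ := ih
    have h1 : IsDiffPoly Ω {p | p.1 = 0 ∨ p.2 < k + 1} (Dx Q.τ) :=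
      hDx (isDiffPoly_τ hQ _) (by simp)
    have h2 : IsDiffPoly Ω {p | p.1 = 0 ∨ p.2 < k + 1} (fun j => j.u 1 k) :=
      .coord 1 k (by simp)
    have h3 : IsDiffPoly Ω {p | p.1 = 0 ∨ p.2 < k + 1} (Dx (Dx Q.τ)) :=
      (hDx (S := {(0, 1)}) (isDiffPoly_τ hQ _) (by simp)).Dx hΩ (by simp) (by simp)
        (by simp +contextual)
    -- The term `D_x τ · u_{1,k+1}` arises `k + 1` times from differentiating the previous leading
    -- term and once from the recursion. Everything else goes into the remainder.
    refine ⟨fun j => -(k + 1) * (Dx (Dx Q.τ) j * j.u 1 k) + Dx G j - j.u 0 (k + 2) * Dx Q.ξ j,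
      .sub (.add _ _ (.mul _ _ (.const _) (.mul _ _ h3 h2)) (hG.Dx hΩ ?_ (by simp) ?_))
        (.mul _ _ (.coord 0 _ (by simp)) (hDx (isDiffPoly_ξ hQ _) (by simp))), fun j hj => ?_⟩
    · intro p hp; simp only [mem_ofPred_eq] at hp ⊢; omega
    · intro i l hp; simp only [mem_ofPred_eq] at hp ⊢; omega
    · rw [prolong_succ, Dx_congr hΩ h hj,
        IsDiffPoly.Dx_add hΩ (.mul _ _ (.const _) (.mul _ _ h1 h2)) hG hj,
        IsDiffPoly.Dx_const_mul hΩ (.mul _ _ h1 h2) _ hj, IsDiffPoly.Dx_mul hΩ h1 h2 hj, Dx_coord]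
      push_cast
      ring

/-- The coefficient of `u_{x…x}` of the highest order in the prolongation coefficients of a vector
field with `D_x τ = 0`. -/
lemma exists_prolong_eq_top (hΩ : IsOpen Ω) (hQ : ContDiffOn ℝ ∞ Q Ω)
    (hτ : ∀ j : Jet, j.point ∈ Ω → Dx Q.τ j = 0) (k : ℕ) :
    ∃ G, IsDiffPoly Ω {p | p.1 = 0 ∧ p.2 < k + 2} G ∧ ∀ j : Jet, j.point ∈ Ω →
      prolong Q 0 (k + 2) j = j.u 0 (k + 2) * (dU (fun p => (Q p).2.2) j.point
        - (k + 2) * dX (fun p => (Q p).2.1) j.point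
        - (k + 3) * (j.u 0 1 * dU (fun p => (Q p).2.1) j.point)) + G j := by
  have hξ := contDiffOn_snd_fst hQ
  have hη := contDiffOn_snd_snd hQ
  have hDξ : ∀ j : Jet, j.point ∈ Ω → Dx Q.ξ j
      = dX (fun p => (Q p).2.1) j.point + j.u 0 1 * dU (fun p => (Q p).2.1) j.point :=
    fun j hj => Dx_comp_point (differentiableAt_of_smooth hΩ hξ hj)
  have hDη : ∀ j : Jet, j.point ∈ Ω → Dx Q.η j
      = dX (fun p => (Q p).2.2) j.point + j.u 0 1 * dU (fun p => (Q p).2.2) j.point :=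
    fun j hj => Dx_comp_point (differentiableAt_of_smooth hΩ hη hj)
  generalize hfξ : (fun p => (Q p).2.1) = fξ at hξ hDξ ⊢
  generalize hfη : (fun p => (Q p).2.2) = fη at hη hDη ⊢
  have bXη : IsDiffPoly Ω ∅ (fun j => dX fη j.point) := .base _ (contDiffOn_dX hΩ hη)
  have bUη : IsDiffPoly Ω ∅ (fun j => dU fη j.point) := .base _ (contDiffOn_dU hΩ hη)
  have bXξ : IsDiffPoly Ω ∅ (fun j => dX fξ j.point) := .base _ (contDiffOn_dX hΩ hξ)
  have bUξ : IsDiffPoly Ω ∅ (fun j => dU fξ j.point) := .base _ (contDiffOn_dU hΩ hξ)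
  have hDx : ∀ {F : Jet → ℝ}, IsDiffPoly Ω ∅ F → IsDiffPoly Ω {(0, 1)} (Dx F) :=
    fun h => h.Dx hΩ (empty_subset _) (by simp) (by simp)
  have c1 : ∀ {S : Set (ℕ × ℕ)}, (0, 1) ∈ S → IsDiffPoly Ω S (fun j => j.u 0 1) :=
    fun h => .coord 0 1 h
  induction k with
  | zero =>
    -- The induction starts at order two because at order one the leading coordinate `u_x` also
    -- occurs inside `D_x ξ`. Differentiating `-u_x² ξ_u` yields `-2u_x u_xx ξ_u`, and the recursion
    -- adds `-u_xx u_x ξ_u`; hence the factor `k + 3` rather than `k + 2`.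
    have hB1 : IsDiffPoly Ω ∅ (fun j => dU fη j.point - dX fξ j.point) := bUη.sub bXξ
    have hB2 : IsDiffPoly Ω {(0, 1)} (fun j => -1 * (j.u 0 1 * dU fξ j.point)) :=
      .mul _ _ (.const _) (.mul _ _ (c1 (mem_singleton _)) (bUξ.mono (empty_subset _)))
    have hB := IsDiffPoly.add _ _ (hB1.mono (S' := {(0, 1)}) (empty_subset _)) hB2
    have hsub : ({(0, 1)} : Set (ℕ × ℕ)) ⊆ {p | p.1 = 0 ∧ p.2 < 0 + 2} := by simp
    refine ⟨fun j => Dx (fun j => dX fη j.point) j + j.u 0 1 *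
      (Dx (fun j => dU fη j.point - dX fξ j.point) j
        + -1 * (j.u 0 1 * Dx (fun j => dU fξ j.point) j)),
      .mono (.add _ _ (hDx bXη) (.mul _ _ (c1 (mem_singleton _)) (.add _ _ (hDx hB1)
        (.mul _ _ (.const _) (.mul _ _ (c1 (mem_singleton _)) (hDx bUξ)))))) hsub, fun j hj => ?_⟩
    have h1 : ∀ j : Jet, j.point ∈ Ω → prolong Q 0 1 j = dX fη j.point +
        j.u 0 1 * ((dU fη j.point - dX fξ j.point) + -1 * (j.u 0 1 * dU fξ j.point)) := by
      intro j hj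
      rw [prolong_succ, show prolong Q 0 0 = Q.η from rfl, hτ j hj, hDξ j hj, hDη j hj]
      ring
    rw [prolong_succ, hτ j hj, hDξ j hj, Dx_congr hΩ h1 hj,
      IsDiffPoly.Dx_add hΩ bXη (.mul _ _ (c1 (mem_singleton _)) hB) hj, IsDiffPoly.Dx_mul hΩ (c1 (mem_singleton _)) hB hj,
      IsDiffPoly.Dx_add hΩ hB1 hB2 hj, IsDiffPoly.Dx_const_mul hΩ
      (.mul _ _ (c1 (mem_singleton _)) (bUξ.mono (empty_subset _))) _ hj,
      IsDiffPoly.Dx_mul hΩ (c1 (mem_singleton _)) (bUξ.mono (empty_subset {(0, 1)})) hj, Dx_coord]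
    push_cast
    ring
  | succ k ih =>
    obtain ⟨G, hG, h⟩ := ih
    have hA : IsDiffPoly Ω {(0, 1)} (fun j => dU fη j.point - (k + 2) * dX fξ j.point
        - (k + 3) * (j.u 0 1 * dU fξ j.point)) :=
      ((bUη.mono (empty_subset _)).sub (.mul _ _ (.const _) (bXξ.mono (empty_subset _)))).sub
        (.mul _ _ (.const _) (.mul _ _ (c1 (mem_singleton _)) (bUξ.mono (empty_subset _))))
    have hc : IsDiffPoly Ω {p | p.1 = 0 ∧ p.2 < k + 3} (fun j => j.u 0 (k + 2)) :=
      .coord 0 _ (by simp)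
    refine ⟨fun j => j.u 0 (k + 2) * Dx (fun j => dU fη j.point - (k + 2) * dX fξ j.point
        - (k + 3) * (j.u 0 1 * dU fξ j.point)) j + Dx G j,
      .add _ _ (.mul _ _ hc (hA.Dx hΩ (by simp) (by simp) (by simp +contextual)))
        (hG.Dx hΩ ?_ (by simp) ?_), fun j hj => ?_⟩
    · intro p hp; simp only [mem_ofPred_eq] at hp ⊢; omega
    · intro i l hp; simp only [mem_ofPred_eq] at hp ⊢; omega
    · rw [prolong_succ, hτ j hj, hDξ j hj, Dx_congr hΩ h hj,
        IsDiffPoly.Dx_add hΩ (.mul _ _ hc (hA.mono (S' := {p | p.1 = 0 ∧ p.2 < k + 3}) (by simp)))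
          hG hj, IsDiffPoly.Dx_mul hΩ hc hA hj, Dx_coord]
      push_cast
      ring

/-- The prolongation coefficients if `D_x τ = 0` and `D_x ξ` is a function annihilated by `D_x`. -/
lemma prolong_eq_iterate (hΩ : IsOpen Ω) (hQ : ContDiffOn ℝ ∞ Q Ω)
    (hτ : ∀ j : Jet, j.point ∈ Ω → Dx Q.τ j = 0) {c : ℝ × ℝ × ℝ → ℝ} (hc : ContDiffOn ℝ ∞ c Ω)
    (hξ : ∀ j : Jet, j.point ∈ Ω → Dx Q.ξ j = c j.point)
    (hDc : ∀ j : Jet, j.point ∈ Ω → Dx (fun j => c j.point) j = 0) (k : ℕ) :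
    IsDiffPoly Ω univ (Dx^[k] Q.η) ∧ ∀ j : Jet, j.point ∈ Ω →
      prolong Q 0 k j = Dx^[k] Q.η j + -k * (c j.point * j.u 0 k) := by
  have hcP : IsDiffPoly Ω univ (fun j => c j.point) := .base _ hc
  induction k with
  | zero =>
    refine ⟨isDiffPoly_η hQ _, fun j hj => ?_⟩
    simp only [Function.iterate_zero, id]
    rw [show prolong Q 0 0 = Q.η from rfl]
    simp
  | succ k ih =>
    have hk : IsDiffPoly Ω univ (fun j => j.u 0 k) := .coord 0 _ (mem_univ _)
    rw [Function.iterate_succ_apply']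
    refine ⟨ih.1.Dx hΩ (by simp) (by simp) (by simp), fun j hj => ?_⟩
    rw [prolong_succ, hτ j hj, hξ j hj, Dx_congr hΩ ih.2 hj,
      IsDiffPoly.Dx_add hΩ ih.1 (.mul _ _ (.const _) (.mul _ _ hcP hk)) hj,
      IsDiffPoly.Dx_const_mul hΩ (.mul _ _ hcP hk) _ hj, IsDiffPoly.Dx_mul hΩ hcP hk hj, Dx_coord,
      hDc j hj]
    push_cast
    ring

/-- The coefficients of the two highest derivatives in the total derivatives `D_x^k` of a function
of `t, x, u`. -/
lemma exists_iterate_Dx_eq (hΩ : IsOpen Ω) {f : ℝ × ℝ × ℝ → ℝ} (hf : ContDiffOn ℝ ∞ f Ω) (k : ℕ) :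
    ∃ G, IsDiffPoly Ω {p | p.1 = 0 ∧ p.2 < k + 2} G ∧ ∀ j : Jet, j.point ∈ Ω →
      Dx^[k + 3] (fun j => f j.point) j = j.u 0 (k + 3) * dU f j.point
        + (j.u 0 (k + 2) * ((k + 3) * Dx (fun j => dU f j.point) j) + G j) := by
  have bX : IsDiffPoly Ω ∅ (fun j => dX f j.point) := .base _ (contDiffOn_dX hΩ hf)
  have bU : IsDiffPoly Ω ∅ (fun j => dU f j.point) := .base _ (contDiffOn_dU hΩ hf)
  have bXX : IsDiffPoly Ω ∅ (fun j => dX (dX f) j.point) :=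
    .base _ (contDiffOn_dX hΩ (contDiffOn_dX hΩ hf))
  have bXU : IsDiffPoly Ω ∅ (fun j => dX (dU f) j.point) :=
    .base _ (contDiffOn_dX hΩ (contDiffOn_dU hΩ hf))
  have bUU : IsDiffPoly Ω ∅ (fun j => dU (dU f) j.point) :=
    .base _ (contDiffOn_dU hΩ (contDiffOn_dU hΩ hf))
  have hDx : ∀ {F : Jet → ℝ}, IsDiffPoly Ω ∅ F → IsDiffPoly Ω {(0, 1)} (Dx F) :=
    fun h => h.Dx hΩ (empty_subset _) (by simp) (by simp)
  have c1 : IsDiffPoly Ω {(0, 1)} (fun j => j.u 0 1) := .coord 0 1 rfl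
  have hU : IsDiffPoly Ω {(0, 1)} (Dx fun j => dU f j.point) := hDx bU
  induction k with
  | zero =>
    -- Order three is the first at which the second-highest derivative has coefficient `k + 3` times
    -- `D_x f_u`: at order two the term `u_x² f_uu` occurs once instead of twice. So the base case
    -- is computed by hand.
    have e1 : ∀ j : Jet, j.point ∈ Ω → Dx (fun j => f j.point) j
        = dX f j.point + j.u 0 1 * dU f j.point :=
      fun j hj => Dx_comp_point (differentiableAt_of_smooth hΩ hf hj)
    have eU : ∀ j : Jet, j.point ∈ Ω → Dx (fun j => dU f j.point) j
        = dX (dU f) j.point + j.u 0 1 * dU (dU f) j.point :=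
      fun j hj => Dx_comp_point (differentiableAt_of_smooth hΩ (contDiffOn_dU hΩ hf) hj)
    have c2 : IsDiffPoly Ω univ (fun j => j.u 0 2) := .coord 0 2 (mem_univ _)
    have b12 : IsDiffPoly Ω {(0, 1)} (fun j => j.u 0 1 * dU (dU f) j.point) :=
      .mul _ _ c1 (bUU.mono (empty_subset _))
    have b11 : IsDiffPoly Ω {(0, 1)} (fun j => 2 * dX (dU f) j.point
        + j.u 0 1 * dU (dU f) j.point) :=
      .add _ _ (.mul _ _ (.const _) (bXU.mono (empty_subset _))) b12
    have b1 : IsDiffPoly Ω {(0, 1)} (fun j => j.u 0 1 * (2 * dX (dU f) j.point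
        + j.u 0 1 * dU (dU f) j.point)) := .mul _ _ c1 b11
    have b2 : IsDiffPoly Ω univ (fun j => j.u 0 2 * dU f j.point) :=
      .mul _ _ c2 (bU.mono (empty_subset _))
    have e2 : ∀ j : Jet, j.point ∈ Ω → Dx (Dx (fun j => f j.point)) j
        = dX (dX f) j.point + (j.u 0 1 * (2 * dX (dU f) j.point
          + j.u 0 1 * dU (dU f) j.point) + j.u 0 2 * dU f j.point) := by
      intro j hj
      rw [Dx_congr hΩ e1 hj, IsDiffPoly.Dx_add hΩ bX (.mul _ _ c1 (bU.mono (empty_subset _))) hj,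
        IsDiffPoly.Dx_mul hΩ c1 bU hj, Dx_coord, eU j hj,
        Dx_comp_point (differentiableAt_of_smooth hΩ (contDiffOn_dX hΩ hf) hj),
        dU_dX_comm hΩ hf hj]
      ring
    refine ⟨fun j => Dx (fun j => dX (dX f) j.point) j
      + j.u 0 1 * (2 * Dx (fun j => dX (dU f) j.point) j
        + j.u 0 1 * Dx (fun j => dU (dU f) j.point) j), .mono (S := {(0, 1)})
      (.add _ _ (hDx bXX) (.mul _ _ c1 (.add _ _ (.mul _ _ (.const _) (hDx bXU))
        (.mul _ _ c1 (hDx bUU))))) (by simp), fun j hj => ?_⟩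
    change Dx (Dx (Dx (fun j => f j.point))) j = _
    rw [Dx_congr hΩ e2 hj, IsDiffPoly.Dx_add hΩ bXX (.add _ _ (b1.mono (subset_univ _)) b2) hj,
      IsDiffPoly.Dx_add hΩ b1 b2 hj, IsDiffPoly.Dx_mul hΩ c1 b11 hj, IsDiffPoly.Dx_mul hΩ c2 bU hj,
      IsDiffPoly.Dx_add hΩ (.mul _ _ (.const _) bXU) b12 hj, IsDiffPoly.Dx_const_mul hΩ bXU _ hj,
      IsDiffPoly.Dx_mul hΩ c1 bUU hj, Dx_coord, Dx_coord, eU j hj]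
    push_cast
    ring
  | succ k ih =>
    obtain ⟨G, hG, h⟩ := ih
    have hUU : IsDiffPoly Ω {p | p.1 = 0 ∧ p.2 < k + 3} (Dx (Dx fun j => dU f j.point)) :=
      hU.Dx hΩ (by simp) (by simp) (by simp +contextual)
    have hc2 : IsDiffPoly Ω {p | p.1 = 0 ∧ p.2 < k + 3} (fun j => j.u 0 (k + 2)) :=
      .coord 0 _ (by simp)
    have hc3 : IsDiffPoly Ω univ (fun j => j.u 0 (k + 3)) := .coord 0 _ (mem_univ _)
    have hm : IsDiffPoly Ω {(0, 1)} (fun j => ((k : ℝ) + 3) * Dx (fun j => dU f j.point) j) :=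
      .mul _ _ (.const _) hU
    refine ⟨fun j => j.u 0 (k + 2) * ((k + 3) * Dx (Dx fun j => dU f j.point) j) + Dx G j,
      .add _ _ (.mul _ _ hc2 (.mul _ _ (.const _) hUU)) (hG.Dx hΩ ?_ (by simp) ?_),
      fun j hj => ?_⟩
    · intro p hp; simp only [mem_ofPred_eq] at hp ⊢; omega
    · intro i l hp; simp only [mem_ofPred_eq] at hp ⊢; omega
    · have hm' := hm.mono (subset_univ _)
      rw [show k + 1 + 3 = (k + 3) + 1 by ring, Function.iterate_succ_apply', Dx_congr hΩ h hj,
        IsDiffPoly.Dx_add hΩ (.mul _ _ hc3 (bU.mono (empty_subset _)))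
          (.add _ _ (.mul _ _ (hc2.mono (subset_univ _)) hm') (hG.mono (subset_univ _))) hj,
        IsDiffPoly.Dx_add hΩ (.mul _ _ (hc2.mono (subset_univ _)) hm') hG hj,
        IsDiffPoly.Dx_mul hΩ hc3 bU hj, IsDiffPoly.Dx_mul hΩ hc2 hm hj,
        IsDiffPoly.Dx_const_mul hΩ hU _ hj, Dx_coord, Dx_coord]
      push_cast
      ring

/-- The total derivatives `D_x^k` of a function of `t, x, u` that is affine in `u` with the
coefficient of `u` depending only on `t`. -/
lemma iterate_Dx_eq_of_affine (hΩ : IsOpen Ω) {f : ℝ × ℝ × ℝ → ℝ} (hf : ContDiffOn ℝ ∞ f Ω)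
    (hXU : ∀ p ∈ Ω, dX (dU f) p = 0) (hUU : ∀ p ∈ Ω, dU (dU f) p = 0) (k : ℕ) :
    ContDiffOn ℝ ∞ (dX^[k + 1] f) Ω ∧ (∀ p ∈ Ω, dU (dX^[k + 1] f) p = 0) ∧
      ∀ j : Jet, j.point ∈ Ω → Dx^[k + 1] (fun j => f j.point) j
        = dX^[k + 1] f j.point + j.u 0 (k + 1) * dU f j.point := by
  induction k with
  | zero =>
    refine ⟨contDiffOn_dX hΩ hf, fun p hp => (dU_dX_comm hΩ hf hp).trans (hXU p hp),
      fun j hj => Dx_comp_point (differentiableAt_of_smooth hΩ hf hj)⟩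
  | succ k ih =>
    obtain ⟨h1, h2, h3⟩ := ih
    have hk : IsDiffPoly Ω univ (fun j => j.u 0 (k + 1)) := .coord 0 _ (mem_univ _)
    have bU : IsDiffPoly Ω univ (fun j => dU f j.point) := .base _ (contDiffOn_dU hΩ hf)
    simp only [Function.iterate_succ_apply' _ (k + 1)]
    refine ⟨contDiffOn_dX hΩ h1, fun p hp => ?_, fun j hj => ?_⟩
    · rw [dU_dX_comm hΩ h1 hp, dX_congr hΩ (g := fun _ => 0) (fun q hq => h2 q hq) hp]
      simp [dX]
    · rw [Dx_congr hΩ h3 hj, IsDiffPoly.Dx_add (S := univ) hΩ (.base _ h1) (.mul _ _ hk bU) hj,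
        IsDiffPoly.Dx_mul hΩ hk bU hj, Dx_coord,
        Dx_comp_point (differentiableAt_of_smooth hΩ h1 hj), h2 _ hj,
        Dx_comp_point (differentiableAt_of_smooth hΩ (contDiffOn_dU hΩ hf) hj), hXU _ hj, hUU _ hj]
      ring


/-! ### Functions on a region -/

section Slices

variable {f : ℝ × ℝ × ℝ → ℝ} {t x u : ℝ}

lemma hasDerivAt_slice_t (hf : DifferentiableAt ℝ f (t, x, u)) :
    HasDerivAt (fun s => f (s, x, u)) (dT f (t, x, u)) t :=
  HasFDerivAt.comp_hasDerivAt (f := fun s : ℝ => (s, x, u)) t hf.hasFDerivAt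
    ((hasDerivAt_id t).prodMk (hasDerivAt_const _ _))

lemma hasDerivAt_slice_x (hf : DifferentiableAt ℝ f (t, x, u)) :
    HasDerivAt (fun s => f (t, s, u)) (dX f (t, x, u)) x :=
  HasFDerivAt.comp_hasDerivAt (f := fun s : ℝ => (t, s, u)) x hf.hasFDerivAt
    ((hasDerivAt_const _ _).prodMk ((hasDerivAt_id x).prodMk (hasDerivAt_const _ _)))

lemma hasDerivAt_slice_u (hf : DifferentiableAt ℝ f (t, x, u)) :
    HasDerivAt (fun s => f (t, x, s)) (dU f (t, x, u)) u :=
  HasFDerivAt.comp_hasDerivAt (f := fun s : ℝ => (t, x, s)) u hf.hasFDerivAt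
    ((hasDerivAt_const _ _).prodMk ((hasDerivAt_const _ _).prodMk (hasDerivAt_id u)))

end Slices

lemma hasDerivAt_unique_of_eqOn {s : Set ℝ} (hs : IsOpen s) {f g : ℝ → ℝ} {f' g' r : ℝ}
    (hf : HasDerivAt f f' r) (hg : HasDerivAt g g' r) (h : EqOn f g s) (hr : r ∈ s) : f' = g' :=
  hf.unique (hg.congr_of_eventuallyEq (h.eventuallyEq_of_mem (hs.mem_nhds hr)))

lemma eq_of_hasDerivAt_zero {s : Set ℝ} (hs : IsOpen s) (hc : IsConnected s) {f : ℝ → ℝ}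
    (h : ∀ r ∈ s, HasDerivAt f 0 r) {a b : ℝ} (ha : a ∈ s) (hb : b ∈ s) : f a = f b :=
  hs.is_const_of_deriv_eq_zero hc.isPreconnected
    (fun r hr => (h r hr).differentiableAt.differentiableWithinAt) (fun r hr => (h r hr).deriv)
    ha hb

namespace Box.Admissible

variable {D : Box} {n : ℤ} {f : ℝ × ℝ × ℝ → ℝ} {t t' x x' u u' : ℝ}

lemma isOpen (hD : D.Admissible n) : IsOpen D.toSet :=
  hD.isOpen_I.prod (hD.isOpen_X.prod hD.isOpen_U)

lemma const_t (hD : D.Admissible n) (hf : ContDiffOn ℝ ∞ f D.toSet)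
    (h : ∀ p ∈ D.toSet, dT f p = 0) (ht : t ∈ D.I) (ht' : t' ∈ D.I) (hx : x ∈ D.X)
    (hu : u ∈ D.U) : f (t, x, u) = f (t', x, u) :=
  eq_of_hasDerivAt_zero (f := fun s => f (s, x, u)) hD.isOpen_I hD.conn_I (fun s hs => by
    have hm : (s, x, u) ∈ D.toSet := ⟨hs, hx, hu⟩
    simpa [h _ hm] using hasDerivAt_slice_t (differentiableAt_of_smooth hD.isOpen hf hm)) ht ht'

lemma const_x (hD : D.Admissible n) (hf : ContDiffOn ℝ ∞ f D.toSet)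
    (h : ∀ p ∈ D.toSet, dX f p = 0) (ht : t ∈ D.I) (hx : x ∈ D.X) (hx' : x' ∈ D.X)
    (hu : u ∈ D.U) : f (t, x, u) = f (t, x', u) :=
  eq_of_hasDerivAt_zero (f := fun s => f (t, s, u)) hD.isOpen_X hD.conn_X (fun s hs => by
    have hm : (t, s, u) ∈ D.toSet := ⟨ht, hs, hu⟩
    simpa [h _ hm] using hasDerivAt_slice_x (differentiableAt_of_smooth hD.isOpen hf hm)) hx hx'

lemma const_u (hD : D.Admissible n) (hf : ContDiffOn ℝ ∞ f D.toSet)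
    (h : ∀ p ∈ D.toSet, dU f p = 0) (ht : t ∈ D.I) (hx : x ∈ D.X) (hu : u ∈ D.U)
    (hu' : u' ∈ D.U) : f (t, x, u) = f (t, x, u') :=
  eq_of_hasDerivAt_zero (f := fun s => f (t, x, s)) hD.isOpen_U hD.conn_U (fun s hs => by
    have hm : (t, x, s) ∈ D.toSet := ⟨ht, hx, hs⟩
    simpa [h _ hm] using hasDerivAt_slice_u (differentiableAt_of_smooth hD.isOpen hf hm)) hu hu'

lemma dX_eq_zero (hD : D.Admissible n) (hf : ContDiffOn ℝ ∞ f D.toSet)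
    (h : ∀ p ∈ D.toSet, ∀ q ∈ D.toSet, p.1 = q.1 → f p = f q) : ∀ p ∈ D.toSet, dX f p = 0 := by
  rintro ⟨t, x, u⟩ hp
  exact hasDerivAt_unique_of_eqOn hD.isOpen_X
    (hasDerivAt_slice_x (differentiableAt_of_smooth hD.isOpen hf hp))
    (hasDerivAt_const x (f (t, x, u))) (fun s hs => h (t, s, u) ⟨hp.1, hs, hp.2.2⟩ _ hp rfl) hp.2.1

lemma dU_eq_zero (hD : D.Admissible n) (hf : ContDiffOn ℝ ∞ f D.toSet)
    (h : ∀ p ∈ D.toSet, ∀ q ∈ D.toSet, p.1 = q.1 → f p = f q) : ∀ p ∈ D.toSet, dU f p = 0 := by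
  rintro ⟨t, x, u⟩ hp
  exact hasDerivAt_unique_of_eqOn hD.isOpen_U
    (hasDerivAt_slice_u (differentiableAt_of_smooth hD.isOpen hf hp))
    (hasDerivAt_const u (f (t, x, u))) (fun s hs => h (t, x, s) ⟨hp.1, hp.2.1, hs⟩ _ hp rfl) hp.2.2

end Box.Admissible

lemma exists_two_mem {s : Set ℝ} (hs : IsOpen s) (hne : s.Nonempty) (c : ℝ) :
    ∃ a ∈ s, ∃ b ∈ s, a ≠ b ∧ a ≠ c ∧ b ≠ c := by
  have hinf : s.Infinite := by
    obtain ⟨r, hr⟩ := hne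
    exact infinite_of_mem_nhds r (hs.mem_nhds hr)
  obtain ⟨a, ha, hac⟩ := hinf.exists_notMem_finite (finite_singleton c)
  obtain ⟨b, hb, hbc⟩ := hinf.exists_notMem_finite (toFinite {a, c})
  simp only [mem_insert_iff, mem_singleton_iff, not_or] at hac hbc
  exact ⟨a, ha, b, hb, fun h => hbc.1 h.symm, hac, hbc.2⟩

/-- The functions `u ^ n`, `u ^ (n - 1)` and `1` are linearly independent on any open set. -/
lemma zpow_lin_indep {n : ℤ} (hn0 : n ≠ 0) (hn1 : n ≠ 1) {U : Set ℝ} (hU : IsOpen U)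
    (hne : U.Nonempty) {A B C : ℝ} (h : ∀ u ∈ U, A * u ^ n + B * u ^ (n - 1) = C) :
    A = 0 ∧ B = 0 ∧ C = 0 := by
  -- Differentiation in `u` removes `C`, and division by `u^(n-2)` leaves an affine function of `u`.
  -- It vanishes at two distinct points, and `n` and `n - 1` are nonzero.
  have hlin : ∀ u ∈ U, u ≠ 0 → n * A * u + (n - 1) * B = 0 := by
    intro u hu hu0
    have h1 := ((hasDerivAt_zpow n u (Or.inl hu0)).const_mul A).add
      ((hasDerivAt_zpow (n - 1) u (Or.inl hu0)).const_mul B)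
    have h2 := hasDerivAt_unique_of_eqOn hU h1 (hasDerivAt_const u C) (fun s hs => h s hs) hu
    have h3 : u ^ (n - 1) = u ^ (n - 1 - 1) * u := by
      rw [← zpow_add_one₀ hu0]; congr 1; ring
    rw [h3] at h2
    have h4 : u ^ (n - 1 - 1) ≠ 0 := zpow_ne_zero _ hu0
    refine (mul_eq_zero.1 (?_ : u ^ (n - 1 - 1) * _ = 0)).resolve_left h4
    push_cast at h2
    linear_combination h2
  obtain ⟨a, ha, b, hb, hab, ha0, hb0⟩ := exists_two_mem hU hne 0
  have hn0' : (n : ℝ) ≠ 0 := mod_cast hn0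
  have hn1' : (n : ℝ) - 1 ≠ 0 := sub_ne_zero.2 (mod_cast hn1)
  have hA : A = 0 := by
    have : n * A * (a - b) = 0 := by linear_combination hlin a ha ha0 - hlin b hb hb0
    simpa [hn0', sub_ne_zero.2 hab] using this
  have hB : B = 0 := by
    have := hlin a ha ha0
    simpa [hA, hn1'] using this
  have hC := h a ha
  simp only [hA, hB, zero_mul, add_zero] at hC
  exact ⟨hA, hB, hC.symm⟩

/-! ### The determining equations -/

/-- The jet over the point `p` with given `x`-derivatives of `u` and of `u_t`. -/
def jetAt (p : ℝ × ℝ × ℝ) (a b : ℕ → ℝ) : Jet :=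
  ⟨p.1, p.2.1, fun i k => match i, k with
    | 0, 0 => p.2.2
    | 0, k + 1 => a (k + 1)
    | 1, k => b k
    | _ + 2, _ => 0⟩

/-- The prolonged vector field applied to the left-hand side of the equation. -/
lemma prolongApply_lhs {n : ℤ} {α β σ : ℝ → ℝ} (Q : VField) {j : Jet} {α' β' σ' : ℝ}
    (hα : HasDerivAt α α' j.t) (hβ : HasDerivAt β β' j.t) (hσ : HasDerivAt σ σ' j.t)
    (hu : j.u 0 0 ≠ 0 ∨ 0 ≤ n) :
    prolongApply Q (lhs n α β σ) j = prolong Q 1 0 j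
      + (α' * Q.τ j * j.u 0 0 ^ n + α j.t * (n * j.u 0 0 ^ (n - 1) * Q.η j)) * j.u 0 1
      + α j.t * j.u 0 0 ^ n * prolong Q 0 1 j
      + (β' * Q.τ j * j.u 0 3 + β j.t * prolong Q 0 3 j)
      + (σ' * Q.τ j * j.u 0 5 + σ j.t * prolong Q 0 5 j) := by
  have hc : ∀ {f : ℝ → ℝ} {f' : ℝ}, HasDerivAt f f' j.t →
      HasDerivAt (fun s => f (j.t + s * Q.τ j)) (f' * Q.τ j) 0 := fun {f f'} hf =>
    HasDerivAt.comp_of_eq (h₂ := f) (0 : ℝ) hf (hasDerivAt_add_mul_const j.t (Q.τ j)) (by simp)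
  have hl : ∀ i k, HasDerivAt (fun s : ℝ => j.u i k + s * prolong Q i k j) (prolong Q i k j) 0 :=
    fun i k => hasDerivAt_add_mul_const _ _
  have hz : HasDerivAt (fun s : ℝ => (j.u 0 0 + s * prolong Q 0 0 j) ^ n)
      (n * j.u 0 0 ^ (n - 1) * prolong Q 0 0 j) 0 :=
    HasDerivAt.comp_of_eq (h₂ := fun r : ℝ => r ^ n) (0 : ℝ) (hasDerivAt_zpow n (j.u 0 0) hu)
      (hl 0 0) (by simp)
  have h := ((((hl 1 0).add (((hc hα).mul hz).mul (hl 0 1))).add ((hc hβ).mul (hl 0 3))).add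
    ((hc hσ).mul (hl 0 5))).deriv
  refine Eq.trans (?_ : _ = _) (h.trans ?_)
  · rfl
  · simp only [Pi.mul_apply, zero_mul, add_zero]
    rw [show prolong Q 0 0 j = Q.η j from rfl]
    ring

lemma IsCoeff.hasDerivAt {I : Set ℝ} (hI : IsOpen I) {f : ℝ → ℝ} (hf : IsCoeff I f) {t : ℝ}
    (ht : t ∈ I) : HasDerivAt f (deriv f t) t :=
  ((hf.1.differentiableOn (by simp)).differentiableAt (hI.mem_nhds ht)).hasDerivAt


section Determining

variable {n : ℤ} {D : Box} {α β σ : ℝ → ℝ} {Q : VField}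

/-- Vector fields `Q` with `Q^{(5)}` annihilating the equation on its solution set. -/
def IsSymmetry (n : ℤ) (D : Box) (α β σ : ℝ → ℝ) (Q : VField) : Prop :=
  ContDiffOn ℝ ∞ Q D.toSet ∧
    ∀ j : Jet, j.point ∈ D.toSet → lhs n α β σ j = 0 → prolongApply Q (lhs n α β σ) j = 0

/-- The determining equation in terms of a jet whose coordinate `u_t` is found from the
equation. -/
lemma IsSymmetry.determining (hD : D.Admissible n) (hα : IsCoeff D.I α) (hβ : IsCoeff D.I β)
    (hσ : IsCoeff D.I σ) (hQ : IsSymmetry n D α β σ Q) {t x u : ℝ} (hp : (t, x, u) ∈ D.toSet)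
    (a b : ℕ → ℝ) (hb : b 0 = -(α t * u ^ n * a 1 + β t * a 3 + σ t * a 5)) :
    prolong Q 1 0 (jetAt (t, x, u) a b)
      + (deriv α t * (Q (t, x, u)).1 * u ^ n
        + α t * (n * u ^ (n - 1) * (Q (t, x, u)).2.2)) * a 1
      + α t * u ^ n * prolong Q 0 1 (jetAt (t, x, u) a b)
      + (deriv β t * (Q (t, x, u)).1 * a 3 + β t * prolong Q 0 3 (jetAt (t, x, u) a b))
      + (deriv σ t * (Q (t, x, u)).1 * a 5 + σ t * prolong Q 0 5 (jetAt (t, x, u) a b)) = 0 := by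
  have ht : t ∈ D.I := hp.1
  have hu : u ≠ 0 ∨ 0 ≤ n := by
    by_contra! h
    exact hD.zero_notMem h.2 (h.1 ▸ hp.2.2)
  have h := hQ.2 (jetAt (t, x, u) a b) hp (by
    change b 0 + α t * u ^ n * a 1 + β t * a 3 + σ t * a 5 = 0
    rw [hb]; ring)
  rw [prolongApply_lhs (j := jetAt (t, x, u) a b) Q (hα.hasDerivAt hD.isOpen_I ht)
    (hβ.hasDerivAt hD.isOpen_I ht) (hσ.hasDerivAt hD.isOpen_I ht) hu] at h
  exact h

lemma prolong_time_jetAt {Ω : Set (ℝ × ℝ × ℝ)} (hΩ : IsOpen Ω) (hQ : ContDiffOn ℝ ∞ Q Ω)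
    {p : ℝ × ℝ × ℝ} (hp : p ∈ Ω) (a b : ℕ → ℝ) : prolong Q 1 0 (jetAt p a b) =
      dT (fun p => (Q p).2.2) p + b 0 * dU (fun p => (Q p).2.2) p
      - b 0 * (dT (fun p => (Q p).1) p + b 0 * dU (fun p => (Q p).1) p)
      - a 1 * (dT (fun p => (Q p).2.1) p + b 0 * dU (fun p => (Q p).2.1) p) := by
  have h : ∀ {f : ℝ × ℝ × ℝ → ℝ}, ContDiffOn ℝ ∞ f Ω → Dt (fun j => f j.point) (jetAt p a b)
      = dT f p + b 0 * dU f p := fun hf =>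
    Dt_comp_point (j := jetAt p a b) (differentiableAt_of_smooth hΩ hf hp)
  rw [prolong_time]
  exact congrArg₂ _ (congrArg₂ _ (h (contDiffOn_snd_snd hQ))
    (congrArg (b 0 * ·) (h (contDiffOn_fst hQ)))) (congrArg (a 1 * ·) (h (contDiffOn_snd_fst hQ)))

lemma Dx_jetAt {Ω : Set (ℝ × ℝ × ℝ)} (hΩ : IsOpen Ω) {f : ℝ × ℝ × ℝ → ℝ}
    (hf : ContDiffOn ℝ ∞ f Ω) {p : ℝ × ℝ × ℝ} (hp : p ∈ Ω) (a b : ℕ → ℝ) :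
    Dx (fun j => f j.point) (jetAt p a b) = dX f p + a 1 * dU f p :=
  Dx_comp_point (j := jetAt p a b) (differentiableAt_of_smooth hΩ hf hp)

/-- This is `eq_of_agree` for the test jets: only the parameters with indices in `S` have to be
compared. -/
lemma IsDiffPoly.jetAt_eq {Ω : Set (ℝ × ℝ × ℝ)} {S : Set (ℕ × ℕ)} {F : Jet → ℝ}
    (hF : IsDiffPoly Ω S F) {p : ℝ × ℝ × ℝ} (hp : p ∈ Ω) {a b a' b' : ℕ → ℝ}
    (ha : ∀ k, (0, k + 1) ∈ S → a' (k + 1) = a (k + 1)) (hb : ∀ k, (1, k) ∈ S → b' k = b k) :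
    F (jetAt p a' b') = F (jetAt p a b) :=
  hF.eq_of_agree hp rfl fun i k hik => match i, k with
    | 0, 0 => rfl
    | 0, k + 1 => ha k hik
    | 1, k => hb k hik
    | _ + 2, _ => rfl

/-- `τ` depends only on `t`. -/
lemma IsSymmetry.partials_τ (hD : D.Admissible n) (hα : IsCoeff D.I α) (hβ : IsCoeff D.I β)
    (hσ : IsCoeff D.I σ) (hQ : IsSymmetry n D α β σ Q) {p : ℝ × ℝ × ℝ} (hp : p ∈ D.toSet) :
    dX (fun p => (Q p).1) p = 0 ∧ dU (fun p => (Q p).1) p = 0 := by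
  have hΩ := hD.isOpen
  obtain ⟨t, x, u⟩ := p
  -- This is `D_x τ = 0` at `u_x = r`; the values `r = 0, 1` separate `τ_x` from `τ_u`.
  have key : ∀ r : ℝ, dX (fun p => (Q p).1) (t, x, u) + r * dU (fun p => (Q p).1) (t, x, u) = 0 := by
    intro r
    set a : ℕ → ℝ := fun k => if k = 1 then r else 0 with ha
    set b : ℕ → ℝ := fun k => if k = 0 then -(α t * u ^ n * r) else 0 with hb
    -- Only `u_{txxxx}` is changed. It does not occur in the equation, so both jets are solutions,
    -- and it enters the determining equation only through the leading term of the fifth-order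
    -- coefficient.
    set b' : ℕ → ℝ := fun k => if k = 4 then 1 else b k with hb'
    have e := hQ.determining hD hα hβ hσ hp a b (by simp [ha, hb])
    have e' := hQ.determining hD hα hβ hσ hp a b' (by simp [ha, hb, hb'])
    rw [prolong_time_jetAt hΩ hQ.1 hp] at e e'
    obtain ⟨G0, hG0, h0⟩ := exists_prolong_eq_mixed hΩ hQ.1 0
    obtain ⟨G2, hG2, h2⟩ := exists_prolong_eq_mixed hΩ hQ.1 2
    obtain ⟨G4, hG4, h4⟩ := exists_prolong_eq_mixed hΩ hQ.1 4
    have hD' : ∀ b, Dx Q.τ (jetAt (t, x, u) a b) = dX (fun p => (Q p).1) (t, x, u)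
        + a 1 * dU (fun p => (Q p).1) (t, x, u) := Dx_jetAt hΩ (contDiffOn_fst hQ.1) hp a
    have hu : ∀ b k, (jetAt (t, x, u) a b).u 1 k = b k := fun _ _ => rfl
    have hpt : ∀ b, (jetAt (t, x, u) a b).point ∈ D.toSet := fun _ => hp
    rw [h0 _ (hpt _), h2 _ (hpt _), h4 _ (hpt _), hD', hu, hu, hu] at e e'
    rw [hG0.jetAt_eq hp (fun _ _ => rfl) (b := b), hG2.jetAt_eq hp (fun _ _ => rfl) (b := b),
      hG4.jetAt_eq hp (fun _ _ => rfl) (b := b)] at e'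
    · simp only [hb', OfNat.zero_ne_ofNat, if_true, if_false, Nat.reduceEqDiff] at e'
      simp only [hb, OfNat.ofNat_ne_zero, if_true, if_false] at e e'
      simp only [ha, if_true] at e e'
      have hσ0 := hσ.2 t hp.1
      have : -5 * σ t * (dX (fun p => (Q p).1) (t, x, u)
          + r * dU (fun p => (Q p).1) (t, x, u)) = 0 := by
        push_cast at e e'
        linear_combination e' - e
      simpa [hσ0] using this
    all_goals
      intro k hk
      simp only [mem_ofPred_eq, one_ne_zero, false_or] at hk
      simp only [hb']
      rw [if_neg (by omega)]
  have h0 := key 0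
  have h1 := key 1
  constructor <;> linarith

lemma IsSymmetry.Dx_τ (hD : D.Admissible n) (hα : IsCoeff D.I α) (hβ : IsCoeff D.I β)
    (hσ : IsCoeff D.I σ) (hQ : IsSymmetry n D α β σ Q) (j : Jet) (hj : j.point ∈ D.toSet) :
    Dx Q.τ j = 0 := by
  have h := hQ.partials_τ hD hα hβ hσ hj
  refine (Dx_comp_point (differentiableAt_of_smooth hD.isOpen (contDiffOn_fst hQ.1) hj)).trans ?_
  rw [h.1, h.2, mul_zero, add_zero]

/-- `ξ` does not depend on `u`, and the equation obtained from the coefficient of `u_xxxxx`. -/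
lemma IsSymmetry.partials_ξ (hD : D.Admissible n) (hα : IsCoeff D.I α) (hβ : IsCoeff D.I β)
    (hσ : IsCoeff D.I σ) (hQ : IsSymmetry n D α β σ Q) {p : ℝ × ℝ × ℝ} (hp : p ∈ D.toSet) :
    dU (fun p => (Q p).2.1) p = 0 ∧ deriv σ p.1 * (Q p).1
      + σ p.1 * (dT (fun p => (Q p).1) p - 5 * dX (fun p => (Q p).2.1) p) = 0 := by
  have hΩ := hD.isOpen
  have hτ := hQ.Dx_τ hD hα hβ hσ
  obtain ⟨t, x, u⟩ := p
  have key : ∀ r : ℝ, deriv σ t * (Q (t, x, u)).1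
      + σ t * (dT (fun p => (Q p).1) (t, x, u) - 5 * dX (fun p => (Q p).2.1) (t, x, u))
      - 5 * σ t * (r * dU (fun p => (Q p).2.1) (t, x, u)) = 0 := by
    intro r
    set a : ℕ → ℝ := fun k => if k = 1 then r else 0 with ha
    set a' : ℕ → ℝ := fun k => if k = 5 then 1 else a k with ha'
    set b : ℕ → ℝ := fun k => if k = 0 then -(α t * u ^ n * r) else 0 with hb
    -- Raising `u_xxxxx` from `0` to `1` must be compensated in `u_t` by `-σ`. The resulting terms
    -- `-σ η_u` and `+σ u_x ξ_u` reduce the coefficient of `u_xxxxx` to the form in `key`.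
    set b' : ℕ → ℝ := fun k => if k = 0 then -(α t * u ^ n * r) - σ t else 0 with hb'
    have e := hQ.determining hD hα hβ hσ hp a b (by simp [ha, hb])
    have e' := hQ.determining hD hα hβ hσ hp a' b' (by simp [ha, ha', hb']; ring)
    rw [prolong_time_jetAt hΩ hQ.1 hp, (hQ.partials_τ hD hα hβ hσ hp).2] at e e'
    obtain ⟨G1, hG1, h1⟩ := exists_prolong_eq_top hΩ hQ.1 hτ 1
    obtain ⟨G3, hG3, h3⟩ := exists_prolong_eq_top hΩ hQ.1 hτ 3
    have hpt : ∀ a b, (jetAt (t, x, u) a b).point ∈ D.toSet := fun _ _ => hp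
    have hp1 : ∀ a b, prolong Q 0 1 (jetAt (t, x, u) a b) = Dx Q.η (jetAt (t, x, u) a b)
        - a 1 * Dx Q.ξ (jetAt (t, x, u) a b) := fun a b => by
      rw [prolong_succ, hτ _ (hpt a b), mul_zero, sub_zero]
      rfl
    have hDη : ∀ a b, Dx Q.η (jetAt (t, x, u) a b) = _ :=
      Dx_jetAt hΩ (contDiffOn_snd_snd hQ.1) hp
    have hDξ : ∀ a b, Dx Q.ξ (jetAt (t, x, u) a b) = _ :=
      Dx_jetAt hΩ (contDiffOn_snd_fst hQ.1) hp
    have hu : ∀ a b k, (jetAt (t, x, u) a b).u 0 (k + 1) = a (k + 1) := fun _ _ _ => rfl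
    have hpe : ∀ a b, (jetAt (t, x, u) a b).point = (t, x, u) := fun _ _ => rfl
    rw [hp1, hDη, hDξ, h1 _ (hpt _ _), h3 _ (hpt _ _), hpe, hu _ _ 2, hu _ _ 4, hu _ _ 0] at e e'
    rw [hG1.jetAt_eq hp (a := a) (b := b), hG3.jetAt_eq hp (a := a) (b := b)] at e'
    · simp only [ha', ha, hb, hb', Nat.reduceAdd, Nat.reduceEqDiff, if_true, if_false,
        OfNat.one_ne_ofNat, OfNat.ofNat_ne_one] at e e'
      push_cast at e e'
      linear_combination e' - e
    all_goals
      intro k hk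
      simp only [mem_ofPred_eq, one_ne_zero, false_and] at hk
      try
        simp only [ha']
        rw [if_neg (by omega)]
  have h0 := key 0
  have h1 := key 1
  have hσ0 := hσ.2 t hp.1
  have h2 : -5 * σ t * dU (fun p => (Q p).2.1) (t, x, u) = 0 := by linear_combination h1 - h0
  refine ⟨by simpa [hσ0] using h2, by linear_combination h0⟩

end Determining


section Determining

variable {n : ℤ} {D : Box} {α β σ : ℝ → ℝ} {Q : VField}

lemma IsSymmetry.Dx_ξ (hD : D.Admissible n) (hα : IsCoeff D.I α) (hβ : IsCoeff D.I β)
    (hσ : IsCoeff D.I σ) (hQ : IsSymmetry n D α β σ Q) (j : Jet) (hj : j.point ∈ D.toSet) :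
    Dx Q.ξ j = dX (fun p => (Q p).2.1) j.point := by
  have h := hQ.partials_ξ hD hα hβ hσ hj
  refine (Dx_comp_point (differentiableAt_of_smooth hD.isOpen (contDiffOn_snd_fst hQ.1) hj)).trans ?_
  rw [h.1, mul_zero, add_zero]

lemma IsSymmetry.τ_eq (hD : D.Admissible n) (hα : IsCoeff D.I α) (hβ : IsCoeff D.I β)
    (hσ : IsCoeff D.I σ) (hQ : IsSymmetry n D α β σ Q) {t x x' u u' : ℝ} (ht : t ∈ D.I)
    (hx : x ∈ D.X) (hx' : x' ∈ D.X) (hu : u ∈ D.U) (hu' : u' ∈ D.U) :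
    (Q (t, x, u)).1 = (Q (t, x', u')).1 :=
  (hD.const_x (contDiffOn_fst hQ.1) (fun _ hp => (hQ.partials_τ hD hα hβ hσ hp).1) ht hx hx'
    hu).trans
  (hD.const_u (contDiffOn_fst hQ.1) (fun _ hp => (hQ.partials_τ hD hα hβ hσ hp).2) ht hx' hu hu')

/-- `ξ_x` depends only on `t`. -/
lemma IsSymmetry.dX_ξ_eq (hD : D.Admissible n) (hα : IsCoeff D.I α) (hβ : IsCoeff D.I β)
    (hσ : IsCoeff D.I σ) (hQ : IsSymmetry n D α β σ Q) :
    ∀ p ∈ D.toSet, ∀ q ∈ D.toSet, p.1 = q.1 →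
      dX (fun p => (Q p).2.1) p = dX (fun p => (Q p).2.1) q := by
  rintro ⟨t, x, u⟩ hp ⟨t', x', u'⟩ hq (rfl : t = t')
  -- Since `σ ≠ 0`, this equation expresses `ξ_x` through `σ`, `τ` and `τ_t`, which are functions of
  -- `t` alone.
  have h1 := (hQ.partials_ξ hD hα hβ hσ hp).2
  have h2 := (hQ.partials_ξ hD hα hβ hσ hq).2
  have hτ := hQ.τ_eq hD hα hβ hσ hp.1 hp.2.1 hq.2.1 hp.2.2 hq.2.2
  have hτ' : dT (fun p => (Q p).1) (t, x, u) = dT (fun p => (Q p).1) (t, x', u') :=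
    hasDerivAt_unique_of_eqOn hD.isOpen_I
      (hasDerivAt_slice_t (differentiableAt_of_smooth hD.isOpen (contDiffOn_fst hQ.1) hp))
      (hasDerivAt_slice_t (differentiableAt_of_smooth hD.isOpen (contDiffOn_fst hQ.1) hq))
      (fun s hs => hQ.τ_eq hD hα hβ hσ hs hp.2.1 hq.2.1 hp.2.2 hq.2.2) hp.1
  have hσ0 := hσ.2 t hp.1
  simp only [hτ, hτ'] at h1 h2
  have h3 : 5 * σ t * (dX (fun p => (Q p).2.1) (t, x, u)
      - dX (fun p => (Q p).2.1) (t, x', u')) = 0 := by linear_combination h2 - h1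
  simpa [hσ0, sub_eq_zero] using h3

/-- Now `D_x τ = 0` and `D_x ξ = ξ_x` is annihilated by `D_x`, so each step of the recursion merely
subtracts one more `ξ_x u_{x…x}`. -/
lemma IsSymmetry.prolong_eq (hD : D.Admissible n) (hα : IsCoeff D.I α) (hβ : IsCoeff D.I β)
    (hσ : IsCoeff D.I σ) (hQ : IsSymmetry n D α β σ Q) (k : ℕ) (j : Jet) (hj : j.point ∈ D.toSet) :
    prolong Q 0 k j = Dx^[k] Q.η j + -k * (dX (fun p => (Q p).2.1) j.point * j.u 0 k) := by
  have hc := contDiffOn_dX hD.isOpen (contDiffOn_snd_fst hQ.1)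
  refine (prolong_eq_iterate hD.isOpen hQ.1 (hQ.Dx_τ hD hα hβ hσ) hc
    (hQ.Dx_ξ hD hα hβ hσ) (fun j hj => ?_) k).2 j hj
  rw [Dx_comp_point (differentiableAt_of_smooth hD.isOpen hc hj),
    hD.dX_eq_zero hc (hQ.dX_ξ_eq hD hα hβ hσ) _ hj, hD.dU_eq_zero hc (hQ.dX_ξ_eq hD hα hβ hσ) _ hj]
  ring

/-- `η` is affine in `u`, and the coefficient of `u` depends only on `t`. -/
lemma IsSymmetry.partials_dU_η (hD : D.Admissible n) (hα : IsCoeff D.I α) (hβ : IsCoeff D.I β)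
    (hσ : IsCoeff D.I σ) (hQ : IsSymmetry n D α β σ Q) {p : ℝ × ℝ × ℝ} (hp : p ∈ D.toSet) :
    dX (dU (fun p => (Q p).2.2)) p = 0 ∧ dU (dU (fun p => (Q p).2.2)) p = 0 := by
  have hΩ := hD.isOpen
  have hη := contDiffOn_snd_snd hQ.1
  obtain ⟨t, x, u⟩ := p
  have key : ∀ r : ℝ, dX (dU (fun p => (Q p).2.2)) (t, x, u)
      + r * dU (dU (fun p => (Q p).2.2)) (t, x, u) = 0 := by
    intro r
    set a : ℕ → ℝ := fun k => if k = 1 then r else 0 with ha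
    -- The equation does not contain `u_xxxx`, so `u_t` needs no compensation. Of the terms present
    -- only `σ D_x^5 η` involves it, with coefficient `5σ D_x(η_u)`.
    set a' : ℕ → ℝ := fun k => if k = 4 then 1 else a k with ha'
    set b : ℕ → ℝ := fun k => if k = 0 then -(α t * u ^ n * r) else 0 with hb
    have e := hQ.determining hD hα hβ hσ hp a b (by simp [ha, hb])
    have e' := hQ.determining hD hα hβ hσ hp a' b (by simp [ha, ha', hb])
    rw [prolong_time_jetAt hΩ hQ.1 hp] at e e'
    obtain ⟨G0, hG0, h0⟩ := exists_iterate_Dx_eq hΩ hη 0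
    obtain ⟨G2, hG2, h2⟩ := exists_iterate_Dx_eq hΩ hη 2
    have hpt : ∀ a b, (jetAt (t, x, u) a b).point ∈ D.toSet := fun _ _ => hp
    have hpe : ∀ a b, (jetAt (t, x, u) a b).point = (t, x, u) := fun _ _ => rfl
    have hu : ∀ a b k, (jetAt (t, x, u) a b).u 0 (k + 1) = a (k + 1) := fun _ _ _ => rfl
    have hi1 : ∀ a b, Dx^[1] Q.η (jetAt (t, x, u) a b) = _ := Dx_jetAt hΩ hη hp
    have hi3 : ∀ a b, Dx^[3] Q.η (jetAt (t, x, u) a b) = _ := fun a b => h0 _ (hpt a b)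
    have hi5 : ∀ a b, Dx^[5] Q.η (jetAt (t, x, u) a b) = _ := fun a b => h2 _ (hpt a b)
    have hDU : ∀ a b, Dx (fun j => dU (fun p => (Q p).2.2) j.point) (jetAt (t, x, u) a b) = _ :=
      Dx_jetAt hΩ (contDiffOn_dU hΩ hη) hp
    have hP := fun k a b => hQ.prolong_eq hD hα hβ hσ k (jetAt (t, x, u) a b) (hpt a b)
    rw [hP, hP, hP, hi1, hi3, hi5, hDU, hpe, hu _ _ 0, hu _ _ 1, hu _ _ 2, hu _ _ 3,
      hu _ _ 4] at e e'
    rw [hG0.jetAt_eq hp (a := a) (b := b), hG2.jetAt_eq hp (a := a) (b := b)] at e'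
    · simp only [ha', ha, Nat.reduceAdd, Nat.reduceEqDiff, if_true, if_false,
        OfNat.one_ne_ofNat, OfNat.ofNat_ne_one] at e e'
      push_cast at e e'
      have hσ0 := hσ.2 t hp.1
      have : 5 * σ t * (dX (dU (fun p => (Q p).2.2)) (t, x, u)
          + r * dU (dU (fun p => (Q p).2.2)) (t, x, u)) = 0 := by
        linear_combination e' - e
      simpa [hσ0] using this
    all_goals
      intro k hk
      simp only [mem_ofPred_eq, one_ne_zero, false_and] at hk
      try
        simp only [ha']
        rw [if_neg (by omega)]
  have h0 := key 0
  have h1 := key 1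
  constructor <;> linarith

/-- The determining equations that remain for `τ = τ(t)`, `ξ = ξ(t, x)`, `ξ_xx = 0`, and `η` affine
in `u` with the coefficient of `u` depending only on `t`. -/
lemma IsSymmetry.reduced (hD : D.Admissible n) (hα : IsCoeff D.I α) (hβ : IsCoeff D.I β)
    (hσ : IsCoeff D.I σ) (hQ : IsSymmetry n D α β σ Q) {t x u : ℝ} (hp : (t, x, u) ∈ D.toSet) :
    dT (fun p => (Q p).2.2) (t, x, u) + α t * u ^ n * dX (fun p => (Q p).2.2) (t, x, u)
      + β t * dX^[3] (fun p => (Q p).2.2) (t, x, u)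
      + σ t * dX^[5] (fun p => (Q p).2.2) (t, x, u) = 0 ∧
    (deriv α t * (Q (t, x, u)).1 + α t * (dT (fun p => (Q p).1) (t, x, u)
        - dX (fun p => (Q p).2.1) (t, x, u))) * u ^ n
      + α t * n * u ^ (n - 1) * (Q (t, x, u)).2.2 = dT (fun p => (Q p).2.1) (t, x, u) ∧
    deriv β t * (Q (t, x, u)).1
      + β t * (dT (fun p => (Q p).1) (t, x, u) - 3 * dX (fun p => (Q p).2.1) (t, x, u)) = 0 := by
  have hΩ := hD.isOpen
  have hη := contDiffOn_snd_snd hQ.1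
  have hI := fun k => (iterate_Dx_eq_of_affine hΩ hη (fun _ h => (hQ.partials_dU_η hD hα hβ hσ h).1)
    (fun _ h => (hQ.partials_dU_η hD hα hβ hσ h).2) k).2.2
  -- The remaining condition is affine in `u_x` and `u_xxx`; its values at `(0,0)`, `(1,0)` and
  -- `(0,1)` give the three coefficients. The mixed coordinates beyond `u_t` no longer matter.
  have key : ∀ a1 a3 : ℝ, _ := fun a1 a3 =>
    hQ.determining hD hα hβ hσ hp (fun k => if k = 1 then a1 else if k = 3 then a3 else 0)
      (fun _ => -(α t * u ^ n * a1 + β t * a3)) (by simp)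
  have hpt : ∀ a b, (jetAt (t, x, u) a b).point ∈ D.toSet := fun _ _ => hp
  have hP := fun k a b => hQ.prolong_eq hD hα hβ hσ k (jetAt (t, x, u) a b) (hpt a b)
  have hi : ∀ k a b, Dx^[k + 1] Q.η (jetAt (t, x, u) a b)
      = dX^[k + 1] (fun p => (Q p).2.2) (t, x, u) + a (k + 1) * dU (fun p => (Q p).2.2) (t, x, u) :=
    fun k a b => hI k _ (hpt a b)
  have hpe : ∀ a b, (jetAt (t, x, u) a b).point = (t, x, u) := fun _ _ => rfl
  have hu : ∀ a b k, (jetAt (t, x, u) a b).u 0 (k + 1) = a (k + 1) := fun _ _ _ => rfl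
  simp only [prolong_time_jetAt hΩ hQ.1 hp, hP, hi 0, hi 2, hi 4, hu _ _ 0, hu _ _ 2, hu _ _ 4, hpe,
    (hQ.partials_τ hD hα hβ hσ hp).2, (hQ.partials_ξ hD hα hβ hσ hp).1, Nat.reduceAdd,
    Nat.reduceEqDiff, if_true, if_false, OfNat.one_ne_ofNat, OfNat.ofNat_ne_one,
    Function.iterate_one, zero_add] at key
  have k0 := key 0 0
  have k1 := key 1 0
  have k3 := key 0 1
  push_cast at k0 k1 k3
  exact ⟨by linear_combination k0, by linear_combination k1 - k0, by linear_combination k3 - k0⟩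

end Determining


/-! ### Form of the symmetries and the classifying equations -/

section Algebra

variable {n : ℤ} {D : Box} {α β σ : ℝ → ℝ} {Q : VField}

/-- The vector field `τ(t) ∂_t + (c₁ x + c₀) ∂_x + c₂ u ∂_u`. -/
def affineField (τ : ℝ → ℝ) (c₀ c₁ c₂ : ℝ) : VField :=
  fun p => (τ p.1, c₁ * p.2.1 + c₀, c₂ * p.2.2)

/-- The equations for the coefficients of the symmetry
`τ(t) ∂_t + (c₁ x + c₀) ∂_x + c₂ u ∂_u`. -/
def Classifying (n : ℤ) (I : Set ℝ) (α β σ τ : ℝ → ℝ) (c₁ c₂ : ℝ) : Prop :=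
  ContDiffOn ℝ ∞ τ I ∧ ∀ t ∈ I,
    HasDerivAt (fun s => α s * τ s) ((c₁ - n * c₂) * α t) t ∧
    HasDerivAt (fun s => β s * τ s) (3 * c₁ * β t) t ∧
    HasDerivAt (fun s => σ s * τ s) (5 * c₁ * σ t) t

/-- `η` is a multiple of `u`, and `ξ` does not depend on `t`. -/
lemma IsSymmetry.η_eq_mul (hn0 : n ≠ 0) (hn1 : n ≠ 1) (hD : D.Admissible n) (hα : IsCoeff D.I α)
    (hβ : IsCoeff D.I β) (hσ : IsCoeff D.I σ) (hQ : IsSymmetry n D α β σ Q) {t x u : ℝ}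
    (hp : (t, x, u) ∈ D.toSet) :
    (Q (t, x, u)).2.2 = dU (fun p => (Q p).2.2) (t, x, u) * u ∧
    dT (fun p => (Q p).2.1) (t, x, u) = 0 ∧
    deriv α t * (Q (t, x, u)).1 + α t * (dT (fun p => (Q p).1) (t, x, u)
        - dX (fun p => (Q p).2.1) (t, x, u)) + α t * n * dU (fun p => (Q p).2.2) (t, x, u) = 0 := by
  have hΩ := hD.isOpen
  have hη := contDiffOn_snd_snd hQ.1
  have hdU : ∀ v ∈ D.U, dU (fun p => (Q p).2.2) (t, x, v) = dU (fun p => (Q p).2.2) (t, x, u) :=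
    fun v hv => hD.const_u (contDiffOn_dU hΩ hη)
      (fun _ h => (hQ.partials_dU_η hD hα hβ hσ h).2) hp.1 hp.2.1 hv hp.2.2
  have hη0 : ∀ v ∈ D.U, (Q (t, x, v)).2.2 - dU (fun p => (Q p).2.2) (t, x, u) * v
      = (Q (t, x, u)).2.2 - dU (fun p => (Q p).2.2) (t, x, u) * u := by
    intro v hv
    refine eq_of_hasDerivAt_zero (f := fun v => (Q (t, x, v)).2.2
      - dU (fun p => (Q p).2.2) (t, x, u) * v) hD.isOpen_U hD.conn_U (fun w hw => ?_) hv hp.2.2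
    have h1 := hasDerivAt_slice_u
      (differentiableAt_of_smooth hΩ hη (show (t, x, w) ∈ D.toSet from ⟨hp.1, hp.2.1, hw⟩))
    have h2 := h1.sub ((hasDerivAt_id w).const_mul (dU (fun p => (Q p).2.2) (t, x, u)))
    rw [hdU w hw, mul_one, sub_self] at h2
    exact h2
  have hdT : ∀ v ∈ D.U, dT (fun p => (Q p).2.1) (t, x, v) = dT (fun p => (Q p).2.1) (t, x, u) :=
    fun v hv => hasDerivAt_unique_of_eqOn hD.isOpen_I
      (hasDerivAt_slice_t (differentiableAt_of_smooth hΩ (contDiffOn_snd_fst hQ.1)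
        ⟨hp.1, hp.2.1, hv⟩))
      (hasDerivAt_slice_t (differentiableAt_of_smooth hΩ (contDiffOn_snd_fst hQ.1) hp))
      (fun s hs => hD.const_u (contDiffOn_snd_fst hQ.1)
        (fun _ h => (hQ.partials_ξ hD hα hβ hσ h).1) hs hp.2.1 hv hp.2.2) hp.1
  have hdTτ : ∀ v ∈ D.U, dT (fun p => (Q p).1) (t, x, v) = dT (fun p => (Q p).1) (t, x, u) :=
    fun v hv => hasDerivAt_unique_of_eqOn hD.isOpen_I
      (hasDerivAt_slice_t (differentiableAt_of_smooth hΩ (contDiffOn_fst hQ.1)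
        ⟨hp.1, hp.2.1, hv⟩))
      (hasDerivAt_slice_t (differentiableAt_of_smooth hΩ (contDiffOn_fst hQ.1) hp))
      (fun s hs => hQ.τ_eq hD hα hβ hσ hs hp.2.1 hp.2.1 hv hp.2.2) hp.1
  -- With `t` and `x` fixed, `η = η_u u + η₀` where `η_u` and `η₀` do not depend on `u`. The
  -- coefficient of `u_x` is then a relation between `u^n`, `u^(n-1)` and `1`, with `B = nαη₀` and
  -- `C = ξ_t`.
  obtain ⟨hA, hB, hC⟩ := zpow_lin_indep hn0 hn1 hD.isOpen_U hD.conn_U.nonempty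
    (A := deriv α t * (Q (t, x, u)).1 + α t * (dT (fun p => (Q p).1) (t, x, u)
        - dX (fun p => (Q p).2.1) (t, x, u)) + α t * n * dU (fun p => (Q p).2.2) (t, x, u))
    (B := α t * n * ((Q (t, x, u)).2.2 - dU (fun p => (Q p).2.2) (t, x, u) * u))
    (C := dT (fun p => (Q p).2.1) (t, x, u)) (fun v hv => by
      have hpv : (t, x, v) ∈ D.toSet := ⟨hp.1, hp.2.1, hv⟩
      have h := (hQ.reduced hD hα hβ hσ hpv).2.1
      rw [hdT v hv, hdTτ v hv, hQ.τ_eq hD hα hβ hσ hp.1 hp.2.1 hp.2.1 hv hp.2.2,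
        hQ.dX_ξ_eq hD hα hβ hσ _ hpv _ hp rfl] at h
      have hz : α t * n * dU (fun p => (Q p).2.2) (t, x, u) * v ^ n
          = α t * n * dU (fun p => (Q p).2.2) (t, x, u) * (v ^ (n - 1) * v) := by
        rcases eq_or_ne v 0 with rfl | hv0
        · simp [zero_zpow n hn0]
        · rw [← zpow_add_one₀ hv0, sub_add_cancel]
      rw [← hη0 v hv]
      linear_combination h + hz)
  have hα0 := hα.2 t hp.1
  have hn : (n : ℝ) ≠ 0 := mod_cast hn0
  exact ⟨sub_eq_zero.1 ((mul_eq_zero.1 hB).resolve_left (mul_ne_zero hα0 hn)), hC.symm ▸ rfl, hA⟩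

/-- From `η = η_u u` with `η_u = η_u(t)` follows `η_x = 0`, and then the `u_x`-free determining
equation gives `η_t = 0`, so `η_u` is constant. From `ξ_t = 0` and `ξ_x = ξ_x(t)` it follows that
`ξ_x` is constant too. -/
lemma IsSymmetry.exists_affine (hn0 : n ≠ 0) (hn1 : n ≠ 1) (hD : D.Admissible n)
    (hα : IsCoeff D.I α) (hβ : IsCoeff D.I β) (hσ : IsCoeff D.I σ)
    (hQ : IsSymmetry n D α β σ Q) : ∃ τ c₀ c₁ c₂, Classifying n D.I α β σ τ c₁ c₂ ∧
      D.toSet.domRestrict Q = D.toSet.domRestrict (affineField τ c₀ c₁ c₂) := by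
  have hΩ := hD.isOpen
  have hξ := contDiffOn_snd_fst hQ.1
  have hη := contDiffOn_snd_snd hQ.1
  obtain ⟨t₀, ht₀⟩ := hD.conn_I.nonempty
  obtain ⟨x₀, hx₀⟩ := hD.conn_X.nonempty
  obtain ⟨u₀, hu₀⟩ := hD.conn_U.nonempty
  have h0 : (t₀, x₀, u₀) ∈ D.toSet := ⟨ht₀, hx₀, hu₀⟩
  have hmul := fun {t x u} (h : (t, x, u) ∈ D.toSet) => hQ.η_eq_mul hn0 hn1 hD hα hβ hσ h
  -- `η` does not depend on `x` and `t`
  have hXη : ∀ p ∈ D.toSet, dX (fun p => (Q p).2.2) p = 0 := by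
    rintro ⟨t, x, u⟩ hp
    refine hasDerivAt_unique_of_eqOn hD.isOpen_X
      (hasDerivAt_slice_x (differentiableAt_of_smooth hΩ hη hp))
      (hasDerivAt_const x (Q (t, x, u)).2.2) (fun s hs => ?_) hp.2.1
    have hs' : (t, s, u) ∈ D.toSet := ⟨hp.1, hs, hp.2.2⟩
    change (Q (t, s, u)).2.2 = (Q (t, x, u)).2.2
    rw [(hmul hs').1, (hmul hp).1, hD.const_x (contDiffOn_dU hΩ hη)
      (fun _ h => (hQ.partials_dU_η hD hα hβ hσ h).1) hp.1 hs hp.2.1 hp.2.2]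
  have hXη' : ∀ k, ∀ p ∈ D.toSet, dX^[k + 1] (fun p => (Q p).2.2) p = 0 := by
    intro k
    induction k with
    | zero => exact hXη
    | succ k ih =>
      intro p hp
      rw [Function.iterate_succ_apply', dX_congr hΩ (g := fun _ => 0) (fun q hq => ih q hq) hp]
      simp [dX]
  have hTη : ∀ p ∈ D.toSet, dT (fun p => (Q p).2.2) p = 0 := by
    rintro ⟨t, x, u⟩ hp
    have h := (hQ.reduced hD hα hβ hσ hp).1
    rwa [hXη' 2 _ hp, hXη' 4 _ hp, hXη _ hp, mul_zero, mul_zero, mul_zero, add_zero, add_zero,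
      add_zero] at h
  have hηeq : ∀ {t x u}, (t, x, u) ∈ D.toSet → (Q (t, x, u)).2.2 = (Q (t₀, x₀, u)).2.2 :=
    fun hp => (hD.const_t hη hTη hp.1 ht₀ hp.2.1 hp.2.2).trans
      (hD.const_x hη hXη ht₀ hp.2.1 hx₀ hp.2.2)
  set c₂ := dU (fun p => (Q p).2.2) (t₀, x₀, u₀) with hc₂
  have hc₂eq : ∀ {t x u}, (t, x, u) ∈ D.toSet → dU (fun p => (Q p).2.2) (t, x, u) = c₂ := by
    intro t x u hp
    have h1 : dU (fun p => (Q p).2.2) (t, x, u) = dU (fun p => (Q p).2.2) (t₀, x₀, u) :=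
      hasDerivAt_unique_of_eqOn hD.isOpen_U
        (hasDerivAt_slice_u (differentiableAt_of_smooth hΩ hη hp))
        (hasDerivAt_slice_u (differentiableAt_of_smooth hΩ hη
          (show (t₀, x₀, u) ∈ D.toSet from ⟨ht₀, hx₀, hp.2.2⟩)))
        (fun s hs => hηeq ⟨hp.1, hp.2.1, hs⟩) hp.2.2
    exact h1.trans (hD.const_u (contDiffOn_dU hΩ hη)
      (fun _ h => (hQ.partials_dU_η hD hα hβ hσ h).2) ht₀ hx₀ hp.2.2 hu₀)
  -- `ξ` is affine in `x`
  have hξeq : ∀ {t x u}, (t, x, u) ∈ D.toSet → (Q (t, x, u)).2.1 = (Q (t₀, x, u₀)).2.1 :=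
    fun hp => (hD.const_t hξ (fun p h => (hmul (t := p.1) (x := p.2.1) (u := p.2.2) h).2.1)
      hp.1 ht₀ hp.2.1 hp.2.2).trans
      (hD.const_u hξ (fun _ h => (hQ.partials_ξ hD hα hβ hσ h).1) ht₀ hp.2.1 hp.2.2 hu₀)
  set c₁ := dX (fun p => (Q p).2.1) (t₀, x₀, u₀) with hc₁
  have hc₁eq : ∀ {t x u}, (t, x, u) ∈ D.toSet → dX (fun p => (Q p).2.1) (t, x, u) = c₁ := by
    intro t x u hp
    have h1 : dX (fun p => (Q p).2.1) (t, x, u) = dX (fun p => (Q p).2.1) (t₀, x, u₀) :=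
      hasDerivAt_unique_of_eqOn hD.isOpen_X
        (hasDerivAt_slice_x (differentiableAt_of_smooth hΩ hξ hp))
        (hasDerivAt_slice_x (differentiableAt_of_smooth hΩ hξ
          (show (t₀, x, u₀) ∈ D.toSet from ⟨ht₀, hp.2.1, hu₀⟩)))
        (fun s hs => hξeq ⟨hp.1, hs, hp.2.2⟩) hp.2.1
    exact h1.trans (hQ.dX_ξ_eq hD hα hβ hσ (t₀, x, u₀) ⟨ht₀, hp.2.1, hu₀⟩ _ h0 rfl)
  have hξaff : ∀ {t x u}, (t, x, u) ∈ D.toSet →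
      (Q (t, x, u)).2.1 = c₁ * x + ((Q (t₀, x₀, u₀)).2.1 - c₁ * x₀) := by
    intro t x u hp
    have h := eq_of_hasDerivAt_zero (f := fun x => (Q (t₀, x, u₀)).2.1 - c₁ * x) hD.isOpen_X
      hD.conn_X (fun s hs => by
        have hs' : (t₀, s, u₀) ∈ D.toSet := ⟨ht₀, hs, hu₀⟩
        have h2 := (hasDerivAt_slice_x (differentiableAt_of_smooth hΩ hξ hs')).sub
          ((hasDerivAt_id s).const_mul c₁)
        rw [hc₁eq hs', mul_one, sub_self] at h2
        exact h2) hp.2.1 hx₀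
    rw [hξeq hp]
    linear_combination h
  refine ⟨fun t => (Q (t, x₀, u₀)).1, (Q (t₀, x₀, u₀)).2.1 - c₁ * x₀, c₁, c₂, ⟨?_, ?_⟩, ?_⟩
  · refine (contDiffOn_fst hQ.1).comp (t := D.toSet) (f := fun t : ℝ => (t, x₀, u₀)) ?_ ?_
    · fun_prop
    · exact fun t ht => ⟨ht, hx₀, hu₀⟩
  · intro t ht
    have hp : (t, x₀, u₀) ∈ D.toSet := ⟨ht, hx₀, hu₀⟩
    have hτ := hasDerivAt_slice_t (differentiableAt_of_smooth hΩ (contDiffOn_fst hQ.1) hp)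
    have e1 := (hmul hp).2.2
    have e2 := (hQ.reduced hD hα hβ hσ hp).2.2
    have e3 := (hQ.partials_ξ hD hα hβ hσ hp).2
    rw [hc₁eq hp] at e1 e2 e3
    rw [hc₂eq hp] at e1
    simp only at e3
    refine ⟨((hα.hasDerivAt hD.isOpen_I ht).mul hτ).congr_deriv ?_,
      ((hβ.hasDerivAt hD.isOpen_I ht).mul hτ).congr_deriv ?_,
      ((hσ.hasDerivAt hD.isOpen_I ht).mul hτ).congr_deriv ?_⟩
    · linear_combination e1
    · linear_combination e2
    · linear_combination e3
  · funext ⟨⟨t, x, u⟩, hp⟩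
    have e3 := (hmul hp).1
    rw [hc₂eq hp] at e3
    exact Prod.ext (hQ.τ_eq hD hα hβ hσ hp.1 hp.2.1 hx₀ hp.2.2 hu₀) (Prod.ext (hξaff hp) e3)

/-- For such a field the prolongation only rescales the coordinates `u_{x…x}` and `u_t`, and the
classifying equations say exactly that the left-hand side of the equation is multiplied by `c₂ -
τ'`. -/
lemma Classifying.isSymmetry (hD : D.Admissible n)
    (hα : IsCoeff D.I α) (hβ : IsCoeff D.I β) (hσ : IsCoeff D.I σ) {τ : ℝ → ℝ} {c₀ c₁ c₂ : ℝ}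
    (h : Classifying n D.I α β σ τ c₁ c₂) : IsSymmetry n D α β σ (affineField τ c₀ c₁ c₂) := by
  have hΩ := hD.isOpen
  set Q := affineField τ c₀ c₁ c₂ with hQdef
  have hQ : ContDiffOn ℝ ∞ Q D.toSet := by
    refine (h.1.comp contDiff_fst.contDiffOn fun p hp => hp.1).prodMk
      (ContDiffOn.prodMk ?_ ?_) <;> fun_prop
  have hτd : ∀ t ∈ D.I, HasDerivAt τ (deriv τ t) t := fun t ht =>
    ((h.1.differentiableOn (by simp)).differentiableAt (hD.isOpen_I.mem_nhds ht)).hasDerivAt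
  have key : ∀ {f : ℝ × ℝ × ℝ → ℝ} {f' : ℝ × ℝ × ℝ →L[ℝ] ℝ} {p : ℝ × ℝ × ℝ},
      HasFDerivAt f f' p → dT f p = f' (1, 0, 0) ∧ dX f p = f' (0, 1, 0) ∧ dU f p = f' (0, 0, 1) :=
    fun hf => by simp only [dT, dX, dU, hf.fderiv, and_self]
  have kτ : ∀ p ∈ D.toSet, dT (fun p => (Q p).1) p = deriv τ p.1 ∧ dX (fun p => (Q p).1) p = 0 ∧
      dU (fun p => (Q p).1) p = 0 := by
    intro p hp
    have h1 := key ((hτd p.1 hp.1).comp_hasFDerivAt p hasFDerivAt_fst)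
    refine ⟨h1.1.trans ?_, h1.2.1.trans ?_, h1.2.2.trans ?_⟩ <;> simp
  have kξ : ∀ p, dT (fun p => (Q p).2.1) p = 0 ∧ dX (fun p => (Q p).2.1) p = c₁ ∧
      dU (fun p => (Q p).2.1) p = 0 := by
    intro p
    have h1 := key ((((hasFDerivAt_snd (𝕜 := ℝ) (E := ℝ) (F := ℝ × ℝ) (p := p)).fst).const_mul
      c₁).add_const c₀)
    refine ⟨h1.1.trans ?_, h1.2.1.trans ?_, h1.2.2.trans ?_⟩ <;> simp
  have kη : ∀ p, dT (fun p => (Q p).2.2) p = 0 ∧ dX (fun p => (Q p).2.2) p = 0 ∧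
      dU (fun p => (Q p).2.2) p = c₂ := by
    intro p
    have h1 := key (((hasFDerivAt_snd (𝕜 := ℝ) (E := ℝ) (F := ℝ × ℝ) (p := p)).snd).const_mul c₂)
    refine ⟨h1.1.trans ?_, h1.2.1.trans ?_, h1.2.2.trans ?_⟩ <;> simp
  have hDτ : ∀ j : Jet, j.point ∈ D.toSet → Dx Q.τ j = 0 := fun j hj => by
    refine (Dx_comp_point (differentiableAt_of_smooth hΩ (contDiffOn_fst hQ) hj)).trans ?_
    rw [(kτ _ hj).2.1, (kτ _ hj).2.2, mul_zero, add_zero]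
  have hDξ : ∀ j : Jet, j.point ∈ D.toSet → Dx Q.ξ j = c₁ := fun j hj => by
    refine (Dx_comp_point (differentiableAt_of_smooth hΩ (contDiffOn_snd_fst hQ) hj)).trans ?_
    rw [(kξ _).2.1, (kξ _).2.2, mul_zero, add_zero]
  have hP : ∀ k, ∀ j : Jet, j.point ∈ D.toSet → prolong Q 0 k j = (c₂ - k * c₁) * j.u 0 k := by
    intro k
    induction k with
    | zero =>
      intro j _
      change c₂ * j.u 0 0 = _
      simp
    | succ k ih =>
      intro j hj
      rw [prolong_succ, hDτ j hj, hDξ j hj, Dx_congr hΩ ih hj,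
        IsDiffPoly.Dx_const_mul (S := univ) hΩ (.coord 0 k (mem_univ _)) _ hj, Dx_coord]
      push_cast
      ring
  refine ⟨hQ, fun j hj hl => ?_⟩
  have hu : j.u 0 0 ≠ 0 ∨ 0 ≤ n := by
    by_contra! hc
    exact hD.zero_notMem hc.2 (hc.1 ▸ hj.2.2)
  have ht : j.t ∈ D.I := hj.1
  have hT : prolong Q 1 0 j = (c₂ - deriv τ j.t) * j.u 1 0 := by
    have hDt : ∀ {f : ℝ × ℝ × ℝ → ℝ}, ContDiffOn ℝ ∞ f D.toSet → Dt (fun j => f j.point) j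
        = dT f j.point + j.u 1 0 * dU f j.point := fun hf =>
      Dt_comp_point (differentiableAt_of_smooth hΩ hf hj)
    have e1 : Dt Q.τ j = _ := hDt (contDiffOn_fst hQ)
    have e2 : Dt Q.ξ j = _ := hDt (contDiffOn_snd_fst hQ)
    have e3 : Dt Q.η j = _ := hDt (contDiffOn_snd_snd hQ)
    rw [prolong_time, e1, e2, e3, (kτ _ hj).1, (kτ _ hj).2.2, (kξ _).1, (kξ _).2.2, (kη _).1,
      (kη _).2.2]
    simp only [Jet.point]
    ring
  have dα := hα.hasDerivAt hD.isOpen_I ht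
  have dβ := hβ.hasDerivAt hD.isOpen_I ht
  have dσ := hσ.hasDerivAt hD.isOpen_I ht
  obtain ⟨h1, h2, h3⟩ := h.2 j.t ht
  have e1 := (dα.mul (hτd _ ht)).unique h1
  have e2 := (dβ.mul (hτd _ ht)).unique h2
  have e3 := (dσ.mul (hτd _ ht)).unique h3
  rw [prolongApply_lhs Q dα dβ dσ hu, hT, hP _ _ hj, hP _ _ hj, hP _ _ hj,
    show Q.τ j = τ j.t from rfl, show Q.η j = c₂ * j.u 0 0 from rfl]
  have hz : (n : ℝ) * j.u 0 0 ^ (n - 1) * j.u 0 0 = n * j.u 0 0 ^ n := by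
    rcases eq_or_ne (j.u 0 0) 0 with h0 | h0
    · rw [h0]
      rcases eq_or_ne n 0 with rfl | hn0
      · simp
      · rw [zero_zpow n hn0, mul_zero, mul_zero]
    · rw [mul_assoc, ← zpow_add_one₀ h0, sub_add_cancel]
  unfold lhs at hl
  push_cast
  linear_combination (c₂ - deriv τ j.t) * hl + j.u 0 0 ^ n * j.u 0 1 * e1 + j.u 0 3 * e2
    + j.u 0 5 * e3 + α j.t * c₂ * j.u 0 1 * hz

/-- The maximal Lie invariance algebra in terms of the solutions of the classifying equations. -/
lemma mem_maxAlg_iff (hn0 : n ≠ 0) (hn1 : n ≠ 1) (hD : D.Admissible n)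
    (hα : IsCoeff D.I α) (hβ : IsCoeff D.I β) (hσ : IsCoeff D.I σ) {v : D.toSet → ℝ × ℝ × ℝ} :
    v ∈ maxAlg n D α β σ ↔ ∃ τ c₀ c₁ c₂, Classifying n D.I α β σ τ c₁ c₂ ∧
      v = D.toSet.domRestrict (affineField τ c₀ c₁ c₂) := by
  constructor
  · rintro ⟨Q, h1, h2, rfl⟩
    exact IsSymmetry.exists_affine hn0 hn1 hD hα hβ hσ ⟨h1, h2⟩
  · rintro ⟨τ, c₀, c₁, c₂, h, rfl⟩
    have hs := h.isSymmetry (c₀ := c₀) hD hα hβ hσ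
    exact ⟨_, hs.1, hs.2, rfl⟩

end Algebra


/-! ### Logarithmic derivatives of the listed coefficients -/

namespace ExtCase

/-- The logarithmic derivative of the coefficient `β` of the case. -/
def logβ : ExtCase → ℝ → ℝ
  | power ρ, t => ρ / t
  | exponential, _ => 1
  | constant, _ => 0

/-- The logarithmic derivative of the coefficient `σ` of the case. -/
def logσ : ExtCase → ℝ → ℝ
  | power ρ, t => (5 * ρ + 2) / 3 / t
  | exponential, _ => 5 / 3
  | constant, _ => 0

lemma hasDerivAt_const_mul_rpow (l ρ : ℝ) {t : ℝ} (ht : 0 < t) :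
    HasDerivAt (fun s : ℝ => l * s ^ ρ) (ρ / t * (l * t ^ ρ)) t := by
  refine ((Real.hasDerivAt_rpow_const (Or.inl ht.ne')).const_mul l).congr_deriv ?_
  rw [Real.rpow_sub_one ht.ne']
  ring

lemma hasDerivAt_const_mul_exp (l c t : ℝ) :
    HasDerivAt (fun s : ℝ => l * Real.exp (c * s)) (c * (l * Real.exp (c * t))) t := by
  refine ((((hasDerivAt_id t).const_mul c).exp).const_mul l).congr_deriv ?_
  simp only [id]
  ring

lemma hasDerivAt_β (c : ExtCase) (l : ℝ) {t : ℝ} (ht : t ∈ c.times) :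
    HasDerivAt (c.β l) (c.logβ t * c.β l t) t := by
  cases c with
  | power ρ => exact hasDerivAt_const_mul_rpow l ρ ht
  | exponential => exact ((Real.hasDerivAt_exp t).const_mul l).congr_deriv (one_mul _).symm
  | constant => exact (hasDerivAt_const t l).congr_deriv (zero_mul _).symm

lemma hasDerivAt_σ (c : ExtCase) (d : ℝ) {t : ℝ} (ht : t ∈ c.times) :
    HasDerivAt (c.σ d) (c.logσ t * c.σ d t) t := by
  cases c with
  | power ρ => exact hasDerivAt_const_mul_rpow d _ ht
  | exponential => exact hasDerivAt_const_mul_exp d (5 / 3) t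
  | constant => exact (hasDerivAt_const t d).congr_deriv (zero_mul _).symm

lemma isCoeff_β (c : ExtCase) {l : ℝ} (hl : l ≠ 0) {I : Set ℝ} (hI : I ⊆ c.times) :
    IsCoeff I (c.β l) := by
  cases c with
  | power ρ =>
    exact ⟨contDiffOn_const.mul (contDiffOn_id.rpow_const_of_ne fun t ht => (hI ht).ne'),
      fun t ht => mul_ne_zero hl (Real.rpow_pos_of_pos (hI ht) _).ne'⟩
  | exponential =>
    exact ⟨contDiffOn_const.mul Real.contDiff_exp.contDiffOn,
      fun t _ => mul_ne_zero hl (Real.exp_ne_zero _)⟩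
  | constant => exact ⟨contDiffOn_const, fun _ _ => hl⟩

lemma isCoeff_σ (c : ExtCase) {d : ℝ} (hd : d ≠ 0) {I : Set ℝ} (hI : I ⊆ c.times) :
    IsCoeff I (c.σ d) := by
  cases c with
  | power ρ =>
    exact ⟨contDiffOn_const.mul (contDiffOn_id.rpow_const_of_ne fun t ht => (hI ht).ne'),
      fun t ht => mul_ne_zero hd (Real.rpow_pos_of_pos (hI ht) _).ne'⟩
  | exponential =>
    exact ⟨contDiffOn_const.mul (Real.contDiff_exp.comp
      (contDiff_const.mul contDiff_id)).contDiffOn,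
      fun t _ => mul_ne_zero hd (Real.exp_ne_zero _)⟩
  | constant => exact ⟨contDiffOn_const, fun _ _ => hd⟩

end ExtCase

lemma isCoeff_one (I : Set ℝ) : IsCoeff I one := ⟨contDiffOn_const, fun _ _ => one_ne_zero⟩

/-! ### Algebras of the listed cases and the kernels -/

section Bases

variable {n : ℤ} {D : Box} {α β σ : ℝ → ℝ}

/-- With `α = 1` the first equation is `τ' = c₁ - nc₂`. Dividing the other two by `β` and `σ` leaves
relations in which the factors `l` and `d` no longer occur. -/
lemma Classifying.exists_of_extCase {c : ExtCase} {l d : ℝ} (hD : D.Admissible n) (hl : l ≠ 0)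
    (hd : d ≠ 0) (hI : D.I ⊆ c.times) {τ : ℝ → ℝ} {c₁ c₂ : ℝ}
    (h : Classifying n D.I one (c.β l) (c.σ d) τ c₁ c₂) :
    ∃ b : ℝ, ∀ t ∈ D.I, τ t = (c₁ - n * c₂) * t + b ∧
      c.logβ t * τ t + (c₁ - n * c₂) = 3 * c₁ ∧ c.logσ t * τ t + (c₁ - n * c₂) = 5 * c₁ := by
  have hτ : ∀ t ∈ D.I, HasDerivAt τ (c₁ - n * c₂) t := fun t ht => by
    simpa [one] using (h.2 t ht).1
  obtain ⟨t₀, ht₀⟩ := hD.conn_I.nonempty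
  refine ⟨τ t₀ - (c₁ - n * c₂) * t₀, fun t ht => ⟨?_, ?_, ?_⟩⟩
  · have := eq_of_hasDerivAt_zero (f := fun t => τ t - (c₁ - n * c₂) * t) hD.isOpen_I hD.conn_I
      (fun s hs => by
        have h2 := (hτ s hs).sub ((hasDerivAt_id s).const_mul (c₁ - n * c₂))
        rw [mul_one, sub_self] at h2
        exact h2) ht ht₀
    linear_combination this
  · have e := ((c.hasDerivAt_β l (hI ht)).mul (hτ t ht)).unique (h.2 t ht).2.1
    refine mul_left_cancel₀ ((c.isCoeff_β hl hI).2 t ht) ?_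
    linear_combination e
  · have e := ((c.hasDerivAt_σ d (hI ht)).mul (hτ t ht)).unique (h.2 t ht).2.2
    refine mul_left_cancel₀ ((c.isCoeff_σ hd hI).2 t ht) ?_
    linear_combination e

lemma Classifying.of_extCase {I : Set ℝ} {c : ExtCase} {l d : ℝ} (hI : I ⊆ c.times) {b c₁ c₂ : ℝ}
    (h : ∀ t ∈ I, c.logβ t * ((c₁ - n * c₂) * t + b) + (c₁ - n * c₂) = 3 * c₁ ∧
      c.logσ t * ((c₁ - n * c₂) * t + b) + (c₁ - n * c₂) = 5 * c₁) :
    Classifying n I one (c.β l) (c.σ d) (fun t => (c₁ - n * c₂) * t + b) c₁ c₂ := by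
  refine ⟨by fun_prop, fun t ht => ?_⟩
  have hτ : HasDerivAt (fun t => (c₁ - n * c₂) * t + b) (c₁ - n * c₂) t := by
    simpa using ((hasDerivAt_id t).const_mul (c₁ - n * c₂)).add_const b
  refine ⟨by simpa [one] using hτ, ((c.hasDerivAt_β l (hI ht)).mul hτ).congr_deriv ?_,
    ((c.hasDerivAt_σ d (hI ht)).mul hτ).congr_deriv ?_⟩
  · linear_combination c.β l t * (h t ht).1
  · linear_combination c.σ d t * (h t ht).2

lemma mem_span_pair_iff {V W : VField} {v : D.toSet → ℝ × ℝ × ℝ} :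
    v ∈ (Submodule.span ℝ (range fun i => D.toSet.domRestrict ((![V, W] : Fin 2 → VField) i)) :
      Submodule ℝ (D.toSet → ℝ × ℝ × ℝ)) ↔
      ∃ s r : ℝ, v = D.toSet.domRestrict (fun p => s • V p + r • W p) := by
  rw [Submodule.mem_span_range_iff_exists_fun]
  constructor
  · rintro ⟨c, rfl⟩
    exact ⟨c 0, c 1, by rw [Fin.sum_univ_two]; rfl⟩
  · rintro ⟨s, r, rfl⟩
    exact ⟨![s, r], by rw [Fin.sum_univ_two]; rfl⟩

/-- The maximal Lie invariance algebras of the listed cases. -/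
lemma isBasisOf_extCase (hn0 : n ≠ 0) (hn1 : n ≠ 1) (hD : D.Admissible n) (c : ExtCase) {l d : ℝ}
    (hl : l ≠ 0) (hd : d ≠ 0) (hI : D.I ⊆ c.times) :
    IsBasisOf D ![partialX, c.generator n] (maxAlg n D one (c.β l) (c.σ d)) := by
  have hn : (n : ℝ) ≠ 0 := mod_cast hn0
  obtain ⟨t₀, ht₀⟩ := hD.conn_I.nonempty
  obtain ⟨x₀, hx₀⟩ := hD.conn_X.nonempty
  obtain ⟨u₀, hu₀⟩ := hD.conn_U.nonempty
  have h0 : (t₀, x₀, u₀) ∈ D.toSet := ⟨ht₀, hx₀, hu₀⟩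
  refine ⟨?_, Set.ext fun v => ?_⟩
  · rw [Fintype.linearIndependent_iff]
    intro g hg
    have e := congrFun hg ⟨(t₀, x₀, u₀), h0⟩
    rw [Fin.sum_univ_two] at e
    have e' : g 0 • partialX (t₀, x₀, u₀) + g 1 • c.generator n (t₀, x₀, u₀) = 0 := e
    have hg1 : g 1 = 0 := by
      have e1 := congrArg Prod.fst e'
      cases c with
      | power ρ =>
        have ht0 : t₀ ≠ 0 := (hI ht₀).ne'
        simpa [partialX, ExtCase.generator, hn, ht0] using e1
      | exponential => simpa [partialX, ExtCase.generator, hn] using e1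
      | constant => simpa [partialX, ExtCase.generator] using e1
    have hg0 : g 0 = 0 := by
      simpa [hg1, partialX] using congrArg (fun p => p.2.1) e'
    exact Fin.forall_fin_two.2 ⟨hg0, hg1⟩
  · rw [SetLike.mem_coe, mem_span_pair_iff,
      mem_maxAlg_iff hn0 hn1 hD (isCoeff_one _) (c.isCoeff_β hl hI) (c.isCoeff_σ hd hI)]
    constructor
    · rintro ⟨τ, c₀, c₁, c₂, h, rfl⟩
      obtain ⟨b, hb⟩ := h.exists_of_extCase hD hl hd hI
      have h1 := (hb t₀ ht₀)
      have hlift : ∀ r : ℝ, (∀ t x u : ℝ, t ∈ D.I → affineField τ c₀ c₁ c₂ (t, x, u)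
          = c₀ • partialX (t, x, u) + r • c.generator n (t, x, u)) →
          ∃ s r : ℝ, D.toSet.domRestrict (affineField τ c₀ c₁ c₂) =
            D.toSet.domRestrict (fun p => s • partialX p + r • c.generator n p) :=
        fun r h => ⟨c₀, r, funext fun p => h _ _ _ p.2.1⟩
      cases c with
      | power ρ =>
        have ht0 : 0 < t₀ := hI ht₀
        simp only [ExtCase.logβ, ExtCase.logσ] at h1
        obtain ⟨e1, e2, e3⟩ := h1
        rw [e1] at e2 e3
        field_simp at e2 e3
        -- This combination eliminates `ρ` and `c₁` from the two relations and leaves `b`.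
        have hb0 : b = 0 := by linear_combination e3 / 2 - 5 / 2 * e2
        subst hb0
        have e4 : (ρ + 1) * (c₁ - n * c₂) = 3 * c₁ :=
          mul_right_cancel₀ ht0.ne' (by linear_combination e2)
        -- The factor is found by comparing the `∂_t` components `(c₁ - nc₂)t` and `3nt`.
        refine hlift ((c₁ - n * c₂) / (3 * n)) fun t x u ht => ?_
        simp only [affineField, partialX, ExtCase.generator, (hb t ht).1, Prod.smul_mk,
          Prod.mk_add_mk, smul_eq_mul, Prod.mk.injEq]
        refine ⟨by field_simp; ring, ?_, ?_⟩ <;> field_simp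
        · linear_combination -x * e4
        · linear_combination -u * e4
      | exponential =>
        simp only [ExtCase.logβ, ExtCase.logσ] at h1
        obtain ⟨e1, e2, e3⟩ := h1
        -- The weights cancel both `τ` and `c₁`. Then `c₁ = nc₂` and `τ = 3c₁ = 3nc₂`, so the
        -- multiple of the generator is `c₂`.
        have ha : c₁ - n * c₂ = 0 := by linear_combination 5 / 2 * e2 - 3 / 2 * e3
        refine hlift c₂ fun t x u ht => ?_
        simp only [affineField, partialX, ExtCase.generator, (hb t ht).1, Prod.smul_mk,
          Prod.mk_add_mk, smul_eq_mul, Prod.mk.injEq]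
        rw [ha] at e1 e2 ⊢
        refine ⟨by linear_combination e2 - e1 + 3 * ha, by linear_combination x * ha, by ring⟩
      | constant =>
        simp only [ExtCase.logβ, ExtCase.logσ] at h1
        obtain ⟨e1, e2, e3⟩ := h1
        have hc1 : c₁ = 0 := by linear_combination e2 / 2 - e3 / 2
        subst hc1
        have hc2 : c₂ = 0 := by
          have : (n : ℝ) * c₂ = 0 := by linear_combination -e2
          simpa [hn] using this
        subst hc2
        refine hlift b fun t x u ht => ?_
        simp [affineField, partialX, ExtCase.generator, (hb t ht).1]
    · rintro ⟨s, r, rfl⟩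
      have hlift : ∀ b c₁ c₂ : ℝ, (∀ t ∈ D.I,
          c.logβ t * ((c₁ - n * c₂) * t + b) + (c₁ - n * c₂) = 3 * c₁ ∧
          c.logσ t * ((c₁ - n * c₂) * t + b) + (c₁ - n * c₂) = 5 * c₁) →
          (∀ t x u : ℝ, t ∈ D.I → s • partialX (t, x, u) + r • c.generator n (t, x, u)
            = ((c₁ - n * c₂) * t + b, c₁ * x + s, c₂ * u)) →
          ∃ τ c₀ c₁ c₂, Classifying n D.I one (c.β l) (c.σ d) τ c₁ c₂ ∧
            D.toSet.domRestrict (fun p => s • partialX p + r • c.generator n p)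
              = D.toSet.domRestrict (affineField τ c₀ c₁ c₂) :=
        fun b c₁ c₂ h h' => ⟨_, s, c₁, c₂, .of_extCase hI h, funext fun p => h' _ _ _ p.2.1⟩
      cases c with
      | power ρ =>
        refine hlift 0 (r * ((ρ + 1) * n)) (r * (ρ - 2)) (fun t ht => ?_) fun t x u ht => ?_
        · have ht0 : t ≠ 0 := (hI ht).ne'
          simp only [ExtCase.logβ, ExtCase.logσ]
          constructor <;> field_simp <;> ring
        · simp only [partialX, ExtCase.generator, Prod.smul_mk, Prod.mk_add_mk, smul_eq_mul,
            Prod.mk.injEq]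
          refine ⟨?_, ?_, ?_⟩ <;> ring
      | exponential =>
        refine hlift (3 * n * r) (r * n) r (fun t ht => ?_) fun t x u ht => ?_
        · simp only [ExtCase.logβ, ExtCase.logσ]
          constructor <;> ring
        · simp only [partialX, ExtCase.generator, Prod.smul_mk, Prod.mk_add_mk, smul_eq_mul,
            Prod.mk.injEq]
          refine ⟨?_, ?_, ?_⟩ <;> ring
      | constant =>
        refine hlift r 0 0 (fun t ht => ?_) fun t x u ht => ?_
        · simp [ExtCase.logβ, ExtCase.logσ]
        · simp [partialX, ExtCase.generator]

lemma spanX_subset_maxAlg (hn0 : n ≠ 0) (hn1 : n ≠ 1) (hD : D.Admissible n) (hα : IsCoeff D.I α)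
    (hβ : IsCoeff D.I β) (hσ : IsCoeff D.I σ) : spanX D ⊆ maxAlg n D α β σ := by
  intro v hv
  obtain ⟨s, rfl⟩ := Submodule.mem_span_singleton.1 hv
  rw [mem_maxAlg_iff hn0 hn1 hD hα hβ hσ]
  refine ⟨fun _ => 0, s, 0, 0, ⟨contDiffOn_const, fun t _ => ?_⟩, funext fun p => ?_⟩
  · simpa using hasDerivAt_const t (0 : ℝ)
  · simp [affineField, partialX]

lemma affineField_mem_spanX {τ : ℝ → ℝ} {c₀ c₁ c₂ : ℝ} (hτ : ∀ t ∈ D.I, τ t = 0) (h1 : c₁ = 0)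
    (h2 : c₂ = 0) : D.toSet.domRestrict (affineField τ c₀ c₁ c₂) ∈ spanX D := by
  refine Submodule.mem_span_singleton.2 ⟨c₀, funext fun p => ?_⟩
  simp [affineField, partialX, hτ _ p.2.1, h1, h2]

/-- Two equations suffice: the constant and the exponential case make sense on every `I`, and their
algebras meet in `⟨∂_x⟩`, because at a point with `u ≠ 0` the `∂_u` component distinguishes the
second generators. -/
lemma kernelGauged_eq (hn0 : n ≠ 0) (hn1 : n ≠ 1) (hD : D.Admissible n) :
    kernelGauged n D = spanX D := by
  refine Subset.antisymm (fun v hv => ?_) fun v hv β σ hβ hσ =>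
    spanX_subset_maxAlg hn0 hn1 hD (isCoeff_one _) hβ hσ hv
  have hmem : ∀ c : ExtCase, D.I ⊆ c.times →
      ∃ s r : ℝ, v = D.toSet.domRestrict (fun p => s • partialX p + r • c.generator n p) :=
    fun c hI => by
      have h := hv _ _ (c.isCoeff_β one_ne_zero hI) (c.isCoeff_σ one_ne_zero hI)
      rw [(isBasisOf_extCase hn0 hn1 hD c one_ne_zero one_ne_zero hI).2] at h
      exact mem_span_pair_iff.1 h
  obtain ⟨s, r, h1⟩ := hmem .constant (subset_univ _)
  obtain ⟨s', r', h2⟩ := hmem .exponential (subset_univ _)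
  obtain ⟨t, ht⟩ := hD.conn_I.nonempty
  obtain ⟨x, hx⟩ := hD.conn_X.nonempty
  obtain ⟨u, hu, -, -, -, hu0, -⟩ := exists_two_mem hD.isOpen_U hD.conn_U.nonempty 0
  have e := congrFun (h1.symm.trans h2) ⟨(t, x, u), ht, hx, hu⟩
  simp [partialX, ExtCase.generator, hu0] at e
  refine Submodule.mem_span_singleton.2 ⟨s', ?_⟩
  rw [h2]
  funext p
  simp [e]

lemma kernelGeneral_eq (hn0 : n ≠ 0) (hn1 : n ≠ 1) (hD : D.Admissible n) :
    kernelGeneral n D = spanX D := by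
  refine Subset.antisymm (fun v hv => ?_) fun v hv α β σ hα hβ hσ =>
    spanX_subset_maxAlg hn0 hn1 hD hα hβ hσ hv
  rw [← kernelGauged_eq hn0 hn1 hD]
  exact fun β σ hβ hσ => hv _ β σ (isCoeff_one _) hβ hσ

end Bases


/-! ### Classification of the coefficients admitting extensions -/

lemma exists_eq_const_mul {s : Set ℝ} (hs : IsOpen s) (hc : IsConnected s) {z w g : ℝ → ℝ}
    (hz : ∀ t ∈ s, HasDerivAt z (g t * z t) t) (hw : ∀ t ∈ s, HasDerivAt w (g t * w t) t)
    (hw0 : ∀ t ∈ s, w t ≠ 0) : ∃ k, ∀ t ∈ s, z t = k * w t := by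
  obtain ⟨t₀, ht₀⟩ := hc.nonempty
  refine ⟨z t₀ / w t₀, fun t ht => ?_⟩
  have h := eq_of_hasDerivAt_zero (f := fun t => z t / w t) hs hc (fun r hr =>
    ((hz r hr).div (hw r hr) (hw0 r hr)).congr_deriv (by ring)) ht ht₀
  exact (div_eq_iff (hw0 t ht)).1 h

lemma exists_antiderivative {s : Set ℝ} (hs : IsOpen s) (hc : IsConnected s) {f : ℝ → ℝ}
    (hf : ContinuousOn f s) : ∃ A : ℝ → ℝ, ∀ t ∈ s, HasDerivAt A (f t) t := by
  obtain ⟨t₀, ht₀⟩ := hc.nonempty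
  refine ⟨fun t => ∫ r in t₀..t, f r, fun t ht => ?_⟩
  refine intervalIntegral.integral_hasDerivAt_right
    ((hf.mono (hc.isPreconnected.ordConnected.uIcc_subset ht₀ ht)).intervalIntegrable)
    (hf.stronglyMeasurableAtFilter hs t ht) (hf.continuousAt (hs.mem_nhds ht))

/-- Constants of a scaling with a given time factor that normalizes the coefficient of the fifth
derivative. -/
lemma exists_scaling {n : ℤ} (hn0 : n ≠ 0) {m k : ℝ} (hm : m ≠ 0) (hk : k ≠ 0) :
    ∃ δ₁ δ₃ : ℝ, δ₁ ≠ 0 ∧ δ₃ ≠ 0 ∧ δ₁ = m * δ₃ ^ n ∧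
      (δ₁ ^ 4 * δ₃ ^ n * k = 1 ∨ δ₁ ^ 4 * δ₃ ^ n * k = -1) := by
  -- With `r = δ₃ⁿ` and `δ₁ = mr` the factor `δ₁⁴δ₃ⁿk` is `m⁴r⁵k`, which has absolute value `1` for
  -- this value of `r⁵`. Then `δ₃` is an `n`-th root of `r`.
  have hpos : 0 < (m ^ 4 * |k|)⁻¹ := by positivity
  obtain ⟨r, hr, hr5⟩ : ∃ r : ℝ, 0 < r ∧ r ^ 5 = (m ^ 4 * |k|)⁻¹ :=
    ⟨_, Real.rpow_pos_of_pos hpos ((5 : ℕ) : ℝ)⁻¹, Real.rpow_inv_natCast_pow hpos.le (by norm_num)⟩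
  obtain ⟨q, hq, hqn⟩ : ∃ q : ℝ, 0 < q ∧ q ^ n = r :=
    ⟨r ^ (n : ℝ)⁻¹, Real.rpow_pos_of_pos hr _, by
      rw [← Real.rpow_intCast, ← Real.rpow_mul hr.le, inv_mul_cancel₀ (mod_cast hn0),
        Real.rpow_one]⟩
  refine ⟨m * r, q, mul_ne_zero hm hr.ne', hq.ne', by rw [hqn], ?_⟩
  have hk' : |k| ≠ 0 := abs_ne_zero.2 hk
  have e : (m * r) ^ 4 * q ^ n * k = k / |k| := by
    rw [hqn, show (m * r) ^ 4 * r * k = m ^ 4 * r ^ 5 * k by ring, hr5]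
    field_simp
  rw [e]
  rcases lt_or_gt_of_ne hk with h | h
  · right; rw [abs_of_neg h, div_neg, div_self hk]
  · left; rw [abs_of_pos h, div_self hk]

section Extensions

variable {n : ℤ} {D : Box} {α β σ : ℝ → ℝ}

lemma ExtCase.β_eq (c : ExtCase) (l t : ℝ) : c.β l t = l * c.β 1 t := by
  cases c <;> simp [ExtCase.β]

lemma ExtCase.σ_eq (c : ExtCase) (d t : ℝ) : c.σ d t = d * c.σ 1 t := by
  cases c <;> simp [ExtCase.σ]

/-- Solving the classifying equation for one of the coefficients. -/
lemma exists_coeff_eq (hI : IsOpen D.I) (hc : IsConnected D.I) (hα : IsCoeff D.I α)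
    (hβ : IsCoeff D.I β) {A τ W Λ : ℝ → ℝ} {S : Set ℝ} {m b y₀ a c₁ : ℝ}
    (hA : ∀ t ∈ D.I, HasDerivAt A (α t) t) (hS : ∀ t ∈ D.I, m * A t + b ∈ S)
    (hW : ∀ r ∈ S, HasDerivAt W (Λ r * W r) r) (hW0 : ∀ r ∈ S, W r ≠ 0)
    (hy : ∀ t ∈ D.I, α t * τ t = a * A t + y₀) (hy0 : ∀ t ∈ D.I, a * A t + y₀ ≠ 0)
    (hβτ : ∀ t ∈ D.I, HasDerivAt (fun s => β s * τ s) (c₁ * β t) t)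
    (hΛ : ∀ t ∈ D.I, (a * A t + y₀) * (m * Λ (m * A t + b)) = c₁ - a) :
    ∃ k, k ≠ 0 ∧ ∀ t ∈ D.I, β t = k * W (m * A t + b) * α t := by
  -- The equation for `βτ = (β/α)(aA + y₀)` fixes the logarithmic derivative of `β/α` where `aA + y₀
  -- ≠ 0`; by `hΛ` it is that of `W(mA + b)`.
  obtain ⟨k, hk⟩ := exists_eq_const_mul hI hc (z := fun t => β t / α t)
    (w := fun t => W (m * A t + b)) (g := fun t => m * α t * Λ (m * A t + b))
    (fun t ht => by
      have h1 := (hβ.hasDerivAt hI ht).div (hα.hasDerivAt hI ht) (hα.2 t ht)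
      refine h1.congr_deriv ?_
      set B' := (deriv β t * α t - β t * deriv α t) / α t ^ 2
      have h2 := h1.mul (((hA t ht).const_mul a).add_const y₀)
      have h3 := hasDerivAt_unique_of_eqOn hI h2 (hβτ t ht) (fun s hs => by
        change β s / α s * (a * A s + y₀) = β s * τ s
        rw [← hy s hs]
        field_simp [hα.2 s hs]) ht
      refine mul_right_cancel₀ (hy0 t ht) ?_
      have h4 : β t / α t * α t = β t := div_mul_cancel₀ _ (hα.2 t ht)
      simp only [Pi.div_apply] at h3
      linear_combination h3 - α t * (β t / α t) * hΛ t ht - c₁ * h4)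
    (fun t ht => ((hW _ (hS t ht)).comp t (((hA t ht).const_mul m).add_const b)).congr_deriv
      (by ring)) (fun t ht => hW0 _ (hS t ht))
  refine ⟨k, ?_, fun t ht => (div_eq_iff (hα.2 t ht)).1 (hk t ht)⟩
  rintro rfl
  obtain ⟨t, ht⟩ := hc.nonempty
  have := hk t ht
  rw [zero_mul, div_eq_zero_iff] at this
  exact this.elim (hβ.2 t ht) (hα.2 t ht)

/-- A single symmetry outside `⟨∂_x⟩` already fixes `β/α` and `σ/α` up to constant factors as
functions of `A`. Working with `A` instead of `t` treats both classes at once. -/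
lemma exists_extCase_of_maxAlg_ne (hn0 : n ≠ 0) (hn1 : n ≠ 1) (hD : D.Admissible n)
    (hα : IsCoeff D.I α) (hβ : IsCoeff D.I β) (hσ : IsCoeff D.I σ)
    (hne : maxAlg n D α β σ ≠ spanX D) {A : ℝ → ℝ} (hA : ∀ t ∈ D.I, HasDerivAt A (α t) t) :
    ∃ (c : ExtCase) (m b k k' : ℝ), m ≠ 0 ∧ k ≠ 0 ∧ k' ≠ 0 ∧ ∀ t ∈ D.I,
      m * A t + b ∈ c.times ∧ β t = k * c.β 1 (m * A t + b) * α t ∧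
        σ t = k' * c.σ 1 (m * A t + b) * α t := by
  have hn : (n : ℝ) ≠ 0 := mod_cast hn0
  obtain ⟨v, hv, hvX⟩ : ∃ v ∈ maxAlg n D α β σ, v ∉ spanX D := by
    by_contra! h
    exact hne (Subset.antisymm h (spanX_subset_maxAlg hn0 hn1 hD hα hβ hσ))
  obtain ⟨τ, c₀, c₁, c₂, ⟨hτs, hτ⟩, rfl⟩ := (mem_maxAlg_iff hn0 hn1 hD hα hβ hσ).1 hv
  obtain ⟨t₀, ht₀⟩ := hD.conn_I.nonempty
  set a := c₁ - n * c₂ with ha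
  set y₀ := α t₀ * τ t₀ - a * A t₀ with hy₀
  have hy : ∀ t ∈ D.I, α t * τ t = a * A t + y₀ := fun t ht => by
    have := eq_of_hasDerivAt_zero (f := fun t => α t * τ t - a * A t) hD.isOpen_I hD.conn_I
      (fun s hs => ((hτ s hs).1.sub ((hA s hs).const_mul a)).congr_deriv (sub_self _)) ht ht₀
    rw [hy₀]
    linear_combination this
  -- `τ` does not vanish
  have hy0 : ∀ t ∈ D.I, a * A t + y₀ ≠ 0 := by
    intro t ht h0
    have hτ0 : τ t = 0 := (mul_eq_zero.1 ((hy t ht).trans h0)).resolve_left (hα.2 t ht)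
    have dτ : HasDerivAt τ (deriv τ t) t :=
      ((hτs.differentiableOn (by simp)).differentiableAt (hD.isOpen_I.mem_nhds ht)).hasDerivAt
    obtain ⟨h1, h2, h3⟩ := hτ t ht
    have e1 := ((hα.hasDerivAt hD.isOpen_I ht).mul dτ).unique h1
    have e2 := ((hβ.hasDerivAt hD.isOpen_I ht).mul dτ).unique h2
    have e3 := ((hσ.hasDerivAt hD.isOpen_I ht).mul dτ).unique h3
    -- At a zero of `τ` the three equations become `τ' = a`, `τ' = 3c₁` and `τ' = 5c₁`, so `a = c₁ =
    -- c₂ = 0`. Then `ατ` is constant, hence zero, and the field is a multiple of `∂_x`.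
    rw [hτ0, mul_zero, zero_add, mul_comm] at e1 e2 e3
    replace e1 := mul_right_cancel₀ (hα.2 t ht) e1
    replace e2 := mul_right_cancel₀ (hβ.2 t ht) e2
    replace e3 := mul_right_cancel₀ (hσ.2 t ht) e3
    have hc1 : c₁ = 0 := by linear_combination e2 / 2 - e3 / 2
    have ha0 : a = 0 := by linear_combination e2 - e1 + 3 * hc1
    have hc2 : c₂ = 0 := by
      have : (n : ℝ) * c₂ = 0 := by linear_combination hc1 - ha0 + ha
      simpa [hn] using this
    refine hvX (affineField_mem_spanX (fun s hs => ?_) hc1 hc2)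
    have hy00 : y₀ = 0 := by rw [ha0] at h0; linear_combination h0
    have := hy s hs
    rw [ha0, hy00, zero_mul, zero_add] at this
    exact (mul_eq_zero.1 this).resolve_left (hα.2 s hs)
  have main : ∀ (c : ExtCase) (m b : ℝ), m ≠ 0 → (∀ t ∈ D.I, m * A t + b ∈ c.times) →
      (∀ t ∈ D.I, (a * A t + y₀) * (m * c.logβ (m * A t + b)) = 3 * c₁ - a) →
      (∀ t ∈ D.I, (a * A t + y₀) * (m * c.logσ (m * A t + b)) = 5 * c₁ - a) →
      ∃ (c : ExtCase) (m b k k' : ℝ), m ≠ 0 ∧ k ≠ 0 ∧ k' ≠ 0 ∧ ∀ t ∈ D.I,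
        m * A t + b ∈ c.times ∧ β t = k * c.β 1 (m * A t + b) * α t ∧
          σ t = k' * c.σ 1 (m * A t + b) * α t := by
    intro c m b hm hS h1 h2
    obtain ⟨k, hk, hk'⟩ := exists_coeff_eq hD.isOpen_I hD.conn_I hα hβ hA hS
      (fun r hr => c.hasDerivAt_β 1 hr) (c.isCoeff_β one_ne_zero Subset.rfl).2 hy hy0
      (fun t ht => (hτ t ht).2.1) h1
    obtain ⟨k₂, hk₂, hk₂'⟩ := exists_coeff_eq hD.isOpen_I hD.conn_I hα hσ hA hS
      (fun r hr => c.hasDerivAt_σ 1 hr) (c.isCoeff_σ one_ne_zero Subset.rfl).2 hy hy0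
      (fun t ht => (hτ t ht).2.2) h2
    exact ⟨c, m, b, k, k₂, hm, hk, hk₂, fun t ht => ⟨hS t ht, hk' t ht, hk₂' t ht⟩⟩
  by_cases ha0 : a = 0
  · have hy00 : y₀ ≠ 0 := by simpa [ha0] using hy0 t₀ ht₀
    simp only [ha0, zero_mul, zero_add, sub_zero] at main
    by_cases hc1 : c₁ = 0
    · exact main .constant 1 0 one_ne_zero (fun _ _ => mem_univ _) (by simp [ExtCase.logβ, hc1])
        (by simp [ExtCase.logσ, hc1])
    · refine main .exponential (3 * c₁ / y₀) 0 (by simp [hc1, hy00]) (fun _ _ => mem_univ _)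
        (fun t _ => ?_) (fun t _ => ?_)
      · simp only [ExtCase.logβ]; field_simp
      · simp only [ExtCase.logσ]; field_simp
  · -- `a A + y₀` has a constant sign
    obtain ⟨ε, hε, hpos⟩ : ∃ ε : ℝ, ε ≠ 0 ∧ ∀ t ∈ D.I, 0 < ε * (a * A t + y₀) := by
      have hcont : ContinuousOn (fun t => a * A t + y₀) D.I := fun t ht =>
        (((hA t ht).const_mul a).add_const y₀).continuousAt.continuousWithinAt
      -- The value at `t₀` itself serves as `ε`; only its sign matters, and a change of sign would
      -- produce a zero.
      refine ⟨a * A t₀ + y₀, hy0 t₀ ht₀, fun t ht => ?_⟩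
      by_contra! hle
      rcases lt_or_gt_of_ne (hy0 t₀ ht₀) with h | h
      · obtain ⟨s, hs, hs'⟩ := hD.conn_I.isPreconnected.intermediate_value ht₀ ht hcont
          (⟨h.le, by simpa using le_of_not_gt fun hlt => by nlinarith⟩ : (0 : ℝ) ∈ Icc _ _)
        exact hy0 s hs hs'
      · obtain ⟨s, hs, hs'⟩ := hD.conn_I.isPreconnected.intermediate_value ht ht₀ hcont
          (⟨by simpa using le_of_not_gt fun hlt => by nlinarith, h.le⟩ : (0 : ℝ) ∈ Icc _ _)
        exact hy0 s hs hs'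
    have hT : ∀ t, ε * a * A t + ε * y₀ = ε * (a * A t + y₀) := fun t => by ring
    -- The logarithmic derivative of `β/α` in `A` is `(3c₁ - a)/(aA + y₀)`, hence `ρ = (3c₁ - a)/a`.
    -- The exponent for `σ` is `(5c₁ - a)/a = (5ρ + 2)/3`. The factor `ε` makes the new time
    -- positive.
    refine main (.power (3 * c₁ / a - 1)) (ε * a) (ε * y₀) (mul_ne_zero hε ha0)
      (fun t ht => by rw [hT]; exact hpos t ht) (fun t ht => ?_) (fun t ht => ?_)
    · have h0 := hy0 t ht
      simp only [ExtCase.logβ, hT]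
      generalize a * A t + y₀ = y at h0
      field_simp
    · have h0 := hy0 t ht
      simp only [ExtCase.logσ, hT]
      generalize a * A t + y₀ = y at h0
      field_simp
      ring

/-- Here `A = t`, and the relation `δ₁ = mδ₃ⁿ` makes the time change of the gauged group equal to
`mt + b`. -/
lemma exists_gaugedEquiv (hn0 : n ≠ 0) (hn1 : n ≠ 1) (hD : D.Admissible n)
    (hβ : IsCoeff D.I β) (hσ : IsCoeff D.I σ) (hne : maxAlg n D one β σ ≠ spanX D) :
    ∃ (D' : Box) (c : ExtCase) (l d : ℝ), l ≠ 0 ∧ (d = 1 ∨ d = -1) ∧ D'.I ⊆ c.times ∧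
      GaugedEquiv n D β σ D' (c.β l) (c.σ d) := by
  obtain ⟨c, m, b, k, k', hm, hk, hk', h⟩ := exists_extCase_of_maxAlg_ne hn0 hn1 hD (isCoeff_one _)
    hβ hσ hne (A := id) (fun t _ => hasDerivAt_id t)
  obtain ⟨δ₁, δ₃, h₁, h₃, e, hd⟩ := exists_scaling hn0 hm hk'
  have h₃n : δ₃ ^ n ≠ 0 := zpow_ne_zero n h₃
  let g : GaugedTransf := ⟨b, δ₁, 0, δ₃, h₁, h₃⟩
  have hg : ∀ t, g.time n t = m * t + b := fun t => by
    simp only [GaugedTransf.time, g, zpow_neg]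
    rw [e]
    field_simp
  refine ⟨g.box n D, c, δ₁ ^ 2 * δ₃ ^ n * k, δ₁ ^ 4 * δ₃ ^ n * k', by positivity, hd, ?_, g, rfl,
    fun t ht => ?_⟩
  · rintro _ ⟨t, ht, rfl⟩
    rw [hg]
    exact (h t ht).1
  · obtain ⟨-, e1, e2⟩ := h t ht
    rw [hg, c.β_eq, c.σ_eq, e1, e2]
    simp only [g, one, id]
    constructor <;> ring

/-- The time `T = mA + b` has `T_t = mα`, so with `δ₁ = mδ₃ⁿ` it also achieves the gauge `α = 1`. -/
lemma exists_generalEquiv (hn0 : n ≠ 0) (hn1 : n ≠ 1) (hD : D.Admissible n)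
    (hα : IsCoeff D.I α) (hβ : IsCoeff D.I β) (hσ : IsCoeff D.I σ)
    (hne : maxAlg n D α β σ ≠ spanX D) :
    ∃ (D' : Box) (c : ExtCase) (l d : ℝ), l ≠ 0 ∧ (d = 1 ∨ d = -1) ∧ D'.I ⊆ c.times ∧
      GeneralEquiv n D α β σ D' one (c.β l) (c.σ d) := by
  obtain ⟨A, hA⟩ := exists_antiderivative hD.isOpen_I hD.conn_I hα.1.continuousOn
  obtain ⟨c, m, b, k, k', hm, hk, hk', h⟩ :=
    exists_extCase_of_maxAlg_ne hn0 hn1 hD hα hβ hσ hne hA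
  obtain ⟨δ₁, δ₃, h₁, h₃, e, hd⟩ := exists_scaling hn0 hm hk'
  have h₃n : δ₃ ^ n ≠ 0 := zpow_ne_zero n h₃
  have hT : ∀ t ∈ D.I, HasDerivAt (fun t => m * A t + b) (m * α t) t := fun t ht =>
    ((hA t ht).const_mul m).add_const b
  let g : GeneralTransf D.I := ⟨fun t => m * A t + b, δ₁, 0, δ₃, by
    rw [contDiffOn_infty_iff_deriv_of_isOpen hD.isOpen_I]
    exact ⟨fun t ht => (hT t ht).differentiableAt.differentiableWithinAt,
      (contDiffOn_const.mul hα.1).congr fun t ht => (hT t ht).deriv⟩,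
    fun t ht => by rw [(hT t ht).deriv]; exact mul_ne_zero hm (hα.2 t ht), h₁, h₃⟩
  refine ⟨g.box, c, δ₁ ^ 2 * δ₃ ^ n * k, δ₁ ^ 4 * δ₃ ^ n * k', by positivity, hd, ?_, g, rfl,
    fun t ht => ?_⟩
  · rintro _ ⟨t, ht, rfl⟩
    exact (h t ht).1
  · obtain ⟨-, e1, e2⟩ := h t ht
    have hα0 := hα.2 t ht
    have hdT : deriv g.T t = m * α t := (hT t ht).deriv
    rw [hdT, c.β_eq, c.σ_eq, e1, e2]
    simp only [g, one]
    rw [e]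
    refine ⟨?_, ?_, ?_⟩ <;> field_simp

end Extensions


/-! ### Inequivalence of the listed cases -/

section Inequivalence

variable {n : ℤ} {D D' : Box} {c c' : ExtCase} {l d l' d' : ℝ}

/-- Coefficients of different cases are not related by an affine change of time and scalings. -/
lemma ExtCase.eq_of_affine_time {I : Set ℝ} (hI : IsOpen I) (hne : I.Nonempty) {m b K K' : ℝ}
    (hm : m ≠ 0) (hl' : l' ≠ 0) (hd' : d' ≠ 0) (hc : I ⊆ c.times)
    (hc' : ∀ t ∈ I, m * t + b ∈ c'.times)
    (hβ : ∀ t ∈ I, c'.β l' (m * t + b) = K * c.β l t)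
    (hσ : ∀ t ∈ I, c'.σ d' (m * t + b) = K' * c.σ d t) : c = c' := by
  obtain ⟨t, ht⟩ := hne
  have hT : HasDerivAt (fun t => m * t + b) m t := by
    simpa using ((hasDerivAt_id t).const_mul m).add_const b
  have e1 : m * c'.logβ (m * t + b) = c.logβ t := by
    have h := hasDerivAt_unique_of_eqOn hI ((c'.hasDerivAt_β l' (hc' t ht)).comp (h₂ := c'.β l')
      t hT) ((c.hasDerivAt_β l (hc ht)).const_mul K) hβ ht
    refine mul_left_cancel₀ ((c'.isCoeff_β hl' Subset.rfl).2 _ (hc' t ht)) ?_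
    linear_combination h - c.logβ t * hβ t ht
  have e2 : m * c'.logσ (m * t + b) = c.logσ t := by
    have h := hasDerivAt_unique_of_eqOn hI ((c'.hasDerivAt_σ d' (hc' t ht)).comp (h₂ := c'.σ d')
      t hT) ((c.hasDerivAt_σ d (hc ht)).const_mul K') hσ ht
    refine mul_left_cancel₀ ((c'.isCoeff_σ hd' Subset.rfl).2 _ (hc' t ht)) ?_
    linear_combination h - c.logσ t * hσ t ht
  -- The weights `5` and `-3` cancel `ρ` in the power case, leaving `-2/t`, and give zero in the
  -- other two. This separates powers from the rest and, between powers, forces `b = 0`, after which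
  -- `e1` compares the exponents.
  have e3 : m * (5 * c'.logβ (m * t + b) - 3 * c'.logσ (m * t + b))
      = 5 * c.logβ t - 3 * c.logσ t := by linear_combination 5 * e1 - 3 * e2
  have hpow : ∀ ρ r : ℝ, 5 * (power ρ).logβ r - 3 * (power ρ).logσ r = -2 / r := fun ρ r => by
    simp only [logβ, logσ]; ring
  have hexp : ∀ r : ℝ, 5 * exponential.logβ r - 3 * exponential.logσ r = 0 := fun r => by
    simp only [logβ, logσ]; norm_num
  have hconst : ∀ r : ℝ, 5 * constant.logβ r - 3 * constant.logσ r = 0 := fun r => by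
    simp only [logβ, logσ]; norm_num
  cases c with
  | power ρ =>
    have ht0 : t ≠ 0 := (hc ht).ne'
    cases c' with
    | power ρ' =>
      have hT0 : m * t + b ≠ 0 := (hc' t ht).ne'
      rw [hpow, hpow] at e3
      simp only [logβ] at e1
      field_simp at e1 e3
      have hb : b = 0 := by linear_combination e3
      rw [hb] at e1
      have : ρ = ρ' := mul_left_cancel₀ (mul_ne_zero hm ht0) (by linear_combination -e1)
      rw [this]
    | exponential => rw [hpow, hexp] at e3; exact absurd e3.symm (by simp [ht0])
    | constant => rw [hpow, hconst] at e3; exact absurd e3.symm (by simp [ht0])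
  | exponential =>
    cases c' with
    | power ρ' =>
      have hT0 : m * t + b ≠ 0 := (hc' t ht).ne'
      rw [hpow, hexp] at e3; simp [hT0, hm] at e3
    | exponential => rfl
    | constant => simp [logβ] at e1
  | constant =>
    cases c' with
    | power ρ' =>
      have hT0 : m * t + b ≠ 0 := (hc' t ht).ne'
      rw [hpow, hconst] at e3; simp [hT0, hm] at e3
    | exponential => simp [logβ, hm] at e1
    | constant => rfl

lemma ExtCase.eq_of_gaugedEquiv (hD : D.Admissible n) (hl' : l' ≠ 0) (hd' : d' ≠ 0)
    (hI : D.I ⊆ c.times) (hI' : D'.I ⊆ c'.times)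
    (h : GaugedEquiv n D (c.β l) (c.σ d) D' (c'.β l') (c'.σ d')) : c = c' := by
  obtain ⟨g, rfl, hg⟩ := h
  exact eq_of_affine_time hD.isOpen_I hD.conn_I.nonempty (m := g.δ₁ * g.δ₃ ^ (-n)) (b := g.δ₀)
    (mul_ne_zero g.δ₁_ne (zpow_ne_zero _ g.δ₃_ne)) hl' hd' hI
    (fun t ht => hI' (mem_image_of_mem _ ht)) (fun t ht => (hg t ht).1) (fun t ht => (hg t ht).2)

/-- Preserving `α = 1` forces `T_t = δ₁δ₃⁻ⁿ`, so `T` is affine on the interval and the comparison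
reduces to the affine one. -/
lemma ExtCase.eq_of_generalEquiv (hD : D.Admissible n) (hl' : l' ≠ 0) (hd' : d' ≠ 0)
    (hI : D.I ⊆ c.times) (hI' : D'.I ⊆ c'.times)
    (h : GeneralEquiv n D one (c.β l) (c.σ d) D' one (c'.β l') (c'.σ d')) : c = c' := by
  obtain ⟨g, rfl, hg⟩ := h
  have h₃n : g.δ₃ ^ n ≠ 0 := zpow_ne_zero n g.δ₃_ne
  set m := g.δ₁ / g.δ₃ ^ n with hm
  have hm0 : m ≠ 0 := div_ne_zero g.δ₁_ne h₃n
  have hder : ∀ t ∈ D.I, deriv g.T t = m := fun t ht => by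
    have e := (hg t ht).1
    have h0 := g.deriv_T_ne t ht
    simp only [one] at e
    rw [mul_one, eq_div_iff (mul_ne_zero h₃n h0)] at e
    rw [hm, eq_div_iff h₃n]
    linear_combination e
  have hT : ∀ t ∈ D.I, HasDerivAt g.T m t := fun t ht => hder t ht ▸
    ((g.smooth_T.differentiableOn (by simp)).differentiableAt
      (hD.isOpen_I.mem_nhds ht)).hasDerivAt
  obtain ⟨t₀, ht₀⟩ := hD.conn_I.nonempty
  have hTeq : ∀ t ∈ D.I, g.T t = m * t + (g.T t₀ - m * t₀) := fun t ht => by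
    have := eq_of_hasDerivAt_zero (f := fun t => g.T t - m * t) hD.isOpen_I hD.conn_I
      (fun s hs => ((hT s hs).sub ((hasDerivAt_id s).const_mul m)).congr_deriv (by ring)) ht ht₀
    linear_combination this
  refine eq_of_affine_time hD.isOpen_I ⟨t₀, ht₀⟩ (m := m) (b := g.T t₀ - m * t₀)
    (K := g.δ₁ ^ 3 / m) (K' := g.δ₁ ^ 5 / m) hm0 hl' hd' hI
    (l := l) (d := d)
    (fun t ht => hTeq t ht ▸ hI' (mem_image_of_mem _ ht)) (fun t ht => ?_) (fun t ht => ?_)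
  · rw [← hTeq t ht, (hg t ht).2.1, hder t ht]
  · rw [← hTeq t ht, (hg t ht).2.2, hder t ht]

end Inequivalence

end Kawahara

end

theorem theorem4 (n : ℤ) (hn0 : n ≠ 0) (hn1 : n ≠ 1) :
    -- the kernel of the class with `α = 1`, and of the class with general `α`
    (∀ D : Kawahara.Box, D.Admissible n →
      Kawahara.kernelGauged n D = Kawahara.spanX D ∧
      Kawahara.kernelGeneral n D = Kawahara.spanX D) ∧
    -- the maximal Lie invariance algebras in the listed cases
    (∀ D : Kawahara.Box, D.Admissible n → ∀ (c : Kawahara.ExtCase) (l d : ℝ),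
      l ≠ 0 → d ≠ 0 → D.I ⊆ c.times →
      Kawahara.IsBasisOf D ![Kawahara.partialX, c.generator n]
        (Kawahara.maxAlg n D Kawahara.one (c.β l) (c.σ d))) ∧
    -- every extension in the class with `α = 1` is equivalent to a listed case with `d = ±1`
    (∀ D : Kawahara.Box, D.Admissible n → ∀ β σ : ℝ → ℝ,
      Kawahara.IsCoeff D.I β → Kawahara.IsCoeff D.I σ →
      Kawahara.maxAlg n D Kawahara.one β σ ≠ Kawahara.spanX D →
      ∃ (D' : Kawahara.Box) (c : Kawahara.ExtCase) (l d : ℝ),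
        l ≠ 0 ∧ (d = 1 ∨ d = -1) ∧ D'.I ⊆ c.times ∧
        Kawahara.GaugedEquiv n D β σ D' (c.β l) (c.σ d)) ∧
    -- every extension in the class with general `α` is equivalent to a listed case with `d = ±1`
    (∀ D : Kawahara.Box, D.Admissible n → ∀ α β σ : ℝ → ℝ,
      Kawahara.IsCoeff D.I α → Kawahara.IsCoeff D.I β → Kawahara.IsCoeff D.I σ →
      Kawahara.maxAlg n D α β σ ≠ Kawahara.spanX D →
      ∃ (D' : Kawahara.Box) (c : Kawahara.ExtCase) (l d : ℝ),
        l ≠ 0 ∧ (d = 1 ∨ d = -1) ∧ D'.I ⊆ c.times ∧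
        Kawahara.GeneralEquiv n D α β σ D' Kawahara.one (c.β l) (c.σ d)) ∧
    -- different cases are inequivalent in either class
    (∀ (D D' : Kawahara.Box), D.Admissible n → D'.Admissible n →
      ∀ (c c' : Kawahara.ExtCase) (l d l' d' : ℝ),
      l ≠ 0 → d ≠ 0 → l' ≠ 0 → d' ≠ 0 → D.I ⊆ c.times → D'.I ⊆ c'.times →
      (Kawahara.GaugedEquiv n D (c.β l) (c.σ d) D' (c'.β l') (c'.σ d') ∨
        Kawahara.GeneralEquiv n D Kawahara.one (c.β l) (c.σ d)
          D' Kawahara.one (c'.β l') (c'.σ d')) →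
      c = c') := by
  refine ⟨fun D hD => ⟨Kawahara.kernelGauged_eq hn0 hn1 hD, Kawahara.kernelGeneral_eq hn0 hn1 hD⟩,
    fun D hD c l d hl hd hI => Kawahara.isBasisOf_extCase hn0 hn1 hD c hl hd hI,
    fun D hD β σ hβ hσ hne => Kawahara.exists_gaugedEquiv hn0 hn1 hD hβ hσ hne,
    fun D hD α β σ hα hβ hσ hne => Kawahara.exists_generalEquiv hn0 hn1 hD hα hβ hσ hne, ?_⟩
  rintro D D' hD - c c' l d l' d' - - hl' hd' hI hI' (h | h)
  · exact Kawahara.ExtCase.eq_of_gaugedEquiv hD hl' hd' hI hI' h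
  · exact Kawahara.ExtCase.eq_of_generalEquiv hD hl' hd' hI hI' h
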